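/- Let $\kappa>0$, and let $G(x)=\frac1{2\pi}\sum_{\mathbf n\in\mathbb Z^2}K_0(\kappa|x-\mathbf n|)$ ($K_0$ the modified Bessel function of the second kind) be the screened Coulomb kernel on the unit torus $[0,1)^2$, i.e. the $\mathbb Z^2$-periodic solution of $-\Delta G+\kappa^2G=\delta$. For $0<\varepsilon<1$ let $\bar\Omega$ be the flat two-dimensional torus of period $\varepsilon^{-1/3}|\ln\varepsilon|^{1/3}$, and for measurable $\bar\Omega^+\subset\bar\Omega$ of finite perimeter $|\partial\bar\Omega^+|$ (in the torus) and $\bar\delta\in\mathbb R$ let $$\bar E(\bar\Omega^+)=|\ln\varepsilon|^{-1}\bigl(|\partial\bar\Omega^+|-2\bar\delta\kappa^{-2}|\bar\Omega^+|\bigr)+2|\ln\varepsilon|^{-2}\int_{\bar\Omega^+}\int_{\bar\Omega^+}G\bigl(\varepsilon^{1/3}|\ln\varepsilon|^{-1/3}(\bar x-\bar y)\bigr)\,d\bar x\,d\bar y .$$ Let $\bar\delta<\frac12\sqrt[3]{9}\,\kappa^2$ be fixed. Then there exists $\varepsilon_0>0$ such that for all $0<\varepsilon\le\varepsilon_0$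 the empty set $\bar\Omega^+=\varnothing$ is the unique minimizer of $\bar E$ among sets of finite perimeter, where sets that differ by a null set are identified; that is, $\varnothing$ is a minimizer and every minimizer has Lebesgue measure zero. -/

import Mathlib

open MeasureTheory

noncomputable section

/-- The Euclidean plane. -/
abbrev Plane : Type := EuclideanSpace ℝ (Fin 2)

/-- The modified Bessel function of the second kind of order zero,
`K₀(z) = ∫₀^∞ exp (-z cosh t) dt` for `z > 0`. -/
def besselK0 (z : ℝ) : ℝ :=
  ∫ t in Set.Ioi (0 : ℝ), Real.exp (-z * Real.cosh t)

/-- The screened Coulomb kernel of the unit torus, that is, the `ℤ²`-periodic solution of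
`-Δ G + κ² G = δ`, given by `G(x) = (2π)⁻¹ ∑_{n ∈ ℤ²} K₀(κ |x - n|)`. -/
def screenedKernel (κ : ℝ) (x : Plane) : ℝ :=
  (1 / (2 * Real.pi)) * ∑' n : ℤ × ℤ, besselK0 (κ * ‖x - !₂[(n.1 : ℝ), (n.2 : ℝ)]‖)

/-- The half-open square `[0, L)²`, the fundamental domain of the flat torus of period `L`. -/
def torusCell (L : ℝ) : Set Plane :=
  {x | ∀ i, x i ∈ Set.Ico 0 L}

/-- The divergence of a vector field on the plane. -/
def divergence (φ : Plane → Plane) (x : Plane) : ℝ :=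
  ∑ i, (fderiv ℝ φ x (EuclideanSpace.single i 1)) i

/-- A `C¹` vector field on the flat torus of period `L` (seen as a periodic field on the plane)
of length at most one. -/
structure IsTorusTestField (L : ℝ) (φ : Plane → Plane) : Prop where
  contDiff : ContDiff ℝ 1 φ
  periodic : ∀ x i, φ (x + EuclideanSpace.single i L) = φ x
  norm_le_one : ∀ x, ‖φ x‖ ≤ 1

/-- The perimeter in the flat torus of period `L` of a set `A ⊆ [0, L)²`, i.e. the total variation
on the torus of its characteristic function. -/
def torusPerimeter (L : ℝ) (A : Set Plane) : ENNReal :=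
  ⨆ (φ : Plane → Plane) (_ : IsTorusTestField L φ), ENNReal.ofReal (∫ x in A, divergence φ x)

/-- The length `ε^{1/3} |ln ε|^{-1/3}` which is the unit of the rescaled coordinate. -/
def lengthScale (ε : ℝ) : ℝ :=
  ε ^ ((1 : ℝ) / 3) * |Real.log ε| ^ (-(1 : ℝ) / 3)

/-- The period `ε^{-1/3} |ln ε|^{1/3}` of the rescaled torus. -/
def rescaledPeriod (ε : ℝ) : ℝ := (lengthScale ε)⁻¹

/-- Measurable subsets of finite perimeter of the rescaled torus. -/
structure IsAdmissible (ε : ℝ) (A : Set Plane) : Prop where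
  subset : A ⊆ torusCell (rescaledPeriod ε)
  measurableSet : MeasurableSet A
  finite_perimeter : torusPerimeter (rescaledPeriod ε) A ≠ ⊤

/-- The rescaled sharp interface energy of the set `A` on which `u = 1`. -/
def rescaledEnergy (κ δbar ε : ℝ) (A : Set Plane) : ℝ :=
  |Real.log ε|⁻¹ *
      ((torusPerimeter (rescaledPeriod ε) A).toReal - 2 * δbar * (κ ^ 2)⁻¹ * volume.real A)
    + 2 * (|Real.log ε| ^ 2)⁻¹ *
      ∫ x in A, ∫ y in A, screenedKernel κ (lengthScale ε • (x - y))

/-- `A` minimizes the rescaled sharp interface energy among the sets of finite perimeter. -/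
structure IsEnergyMinimizer (κ δbar ε : ℝ) (A : Set Plane) : Prop where
  admissible : IsAdmissible ε A
  energy_le : ∀ B, IsAdmissible ε B → rescaledEnergy κ δbar ε A ≤ rescaledEnergy κ δbar ε B

end

open Set Filter Topology ENNReal

/-! ### The modified Bessel function `K₀` -/

/-! Write `t = |ln ε|`, let `S` be the periodic extension of `A`, and for a fixed radius `ρ` let `B`
be the integral over `x ∈ A` of the area of `S` in the disc of radius `ρ` about `x`. For small `ε`
the kernel inside such discs is at least `t / (6π)`, because `K₀(z) ≥ -ln z - 1/2` and the length
scale contributes `t / 3`. So the interaction term is at least `t⁻¹ B / (3π)` (`exists_besselK0_ge`,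
`interaction_ge`). It remains to bound the perimeter below by a multiple of `|A|` minus slightly
less than `B / (3π)`.

The heuristic is the energy of isolated discs: a disc of radius `R` costs `2/R + R²/3` per unit area
(up to the factor `t⁻¹`), which is least at `R³ = 3`, with value `3/R = 9^{1/3}`. This is the
threshold for `2 δbar / κ²`.

The rigorous bound, `perimeter_ge`, comes from a calibration. The Newtonian field `∫_S (x - y) / |x
- y|² dy` has divergence `2π` on `S`. By a bathtub argument, a density in `[0, 1]` of mass `a`
produces a field of length at most `(πR² + a) / (2R)` (`norm_integral_newtonian_le`), with equality
at boundary points of a disc of radius `R`. Cutting the field off at a large scale `M` makes `a` the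
local area of `S`. Multiplication by `2R / (πR² + a)` then gives a periodic test field of length at
most one with divergence about `4πR / (πR² + a)` on `S`. The tangent line at `a = πR²` bounds this
below by `3/R - a / (πR³)`. Cutoff errors are of order `B / M`, with `ρ = 3M`. Taking `R³` slightly
above `3` makes `1 / (πR³) < 1 / (3π)`, and a large `M` fits the error into the gap
(`rescaledEnergy_ge`). The energy is then at least a positive multiple of `|A|`. -/

theorem besselK0_nonneg (z : ℝ) : 0 ≤ besselK0 z :=
  integral_nonneg fun _ => (Real.exp_pos _).le

theorem measurable_besselK0 : Measurable besselK0 := by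
  have h : StronglyMeasurable (fun p : ℝ × ℝ => Real.exp (-p.1 * Real.cosh p.2)) := by
    apply Continuous.stronglyMeasurable
    fun_prop
  exact (h.integral_prod_right (ν := volume.restrict (Ioi (0 : ℝ)))).measurable

theorem integrableOn_exp_neg_mul_cosh {z : ℝ} (hz : 0 < z) :
    IntegrableOn (fun t : ℝ => Real.exp (-z * Real.cosh t)) (Ioi 0) := by
  refine Integrable.mono' (exp_neg_integrableOn_Ioi 0 hz) ?_ ?_
  · exact (Continuous.aestronglyMeasurable (by fun_prop))
  · filter_upwards [ae_restrict_mem measurableSet_Ioi] with t ht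
    rw [Real.norm_of_nonneg (Real.exp_pos _).le]
    apply Real.exp_le_exp.2
    have h1 : t ≤ Real.sinh t := Real.self_le_sinh_iff.2 (le_of_lt ht)
    have h2 := Real.sinh_lt_cosh t
    nlinarith

/-- The logarithmic lower bound for `K₀` at the origin, with the sharp leading coefficient. -/
theorem neg_log_sub_half_le_besselK0 {z : ℝ} (hz : 0 < z) :
    -Real.log z - 1 / 2 ≤ besselK0 z := by
  rcases le_or_gt 1 z with h1 | h1
  · have := Real.log_nonneg h1
    linarith [besselK0_nonneg z]
  -- `T` is the point where `z * exp T = 1`. On `[0, T]` the integrand is at least `1 - z cosh t`,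
  -- whose integral is `T` minus the loss `z sinh T ≤ 1/2`.
  set T := -Real.log z with hT
  have hT0 : 0 < T := by
    have := Real.log_neg hz h1
    linarith
  have hexp : z * Real.exp T = 1 := by
    rw [hT, Real.exp_neg, Real.exp_log hz]
    field_simp
  have hint : ∫ t in (0 : ℝ)..T, (1 - z * Real.cosh t) = T - z * Real.sinh T := by
    have hc : IntervalIntegrable (fun t => z * Real.cosh t) volume 0 T :=
      Continuous.intervalIntegrable (by fun_prop) _ _
    have hcosh : ∫ t in (0 : ℝ)..T, Real.cosh t = Real.sinh T - Real.sinh 0 :=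
      intervalIntegral.integral_eq_sub_of_hasDerivAt (fun t _ => Real.hasDerivAt_sinh t)
        (Real.continuous_cosh.intervalIntegrable _ _)
    rw [intervalIntegral.integral_sub (by simp) hc, intervalIntegral.integral_const_mul, hcosh]
    simp
  have hle : ∫ t in (0 : ℝ)..T, (1 - z * Real.cosh t) ≤ besselK0 z := by
    rw [intervalIntegral.integral_of_le hT0.le]
    calc ∫ t in Ioc 0 T, (1 - z * Real.cosh t)
        ≤ ∫ t in Ioc 0 T, Real.exp (-z * Real.cosh t) := by
          apply setIntegral_mono_on
          · exact (Continuous.integrableOn_Icc (by fun_prop)).mono_set Ioc_subset_Icc_self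
          · exact (integrableOn_exp_neg_mul_cosh hz).mono_set Ioc_subset_Ioi_self
          · exact measurableSet_Ioc
          · intro t _
            have := Real.add_one_le_exp (-z * Real.cosh t)
            linarith
      _ ≤ besselK0 z := by
          apply setIntegral_mono_set (integrableOn_exp_neg_mul_cosh hz)
          · exact Eventually.of_forall fun _ => (Real.exp_pos _).le
          · exact Ioc_subset_Ioi_self.eventuallyLE
  have hs : Real.sinh T ≤ Real.exp T / 2 := by
    rw [Real.sinh_eq]
    linarith [Real.exp_pos (-T)]
  have : z * Real.sinh T ≤ 1 / 2 := by
    calc z * Real.sinh T ≤ z * (Real.exp T / 2) := by gcongr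
      _ = 1 / 2 := by rw [← mul_div_assoc, hexp]
  linarith

theorem lintegral_comp_smul_plane (f : Plane → ℝ≥0∞) (hf : Measurable f) {r : ℝ} (hr : 0 < r) :
    ∫⁻ z, f (r • z) = ENNReal.ofReal ((r ^ 2)⁻¹) * ∫⁻ z, f z := by
  rw [← lintegral_map hf (measurable_const_smul r), Measure.map_addHaar_smul _ hr.ne',
    lintegral_smul_measure]
  simp

theorem lintegral_exp_neg_norm_lt_top :
    ∫⁻ z : Plane, ENNReal.ofReal (Real.exp (-‖z‖)) < ∞ := by
  have h : Integrable (fun z : Plane => Real.exp (-‖z‖)) := by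
    rw [integrable_fun_norm_addHaar (μ := (volume : Measure Plane)) (f := fun y => Real.exp (-y))]
    have := Real.GammaIntegral_convergent (s := 2) (by norm_num)
    refine this.congr_fun (fun y _ => ?_) measurableSet_Ioi
    simp
    norm_num
    ring
  exact h.lintegral_lt_top

/-- By Tonelli the plane integral is taken first: dilation gives a constant times `(c cosh t)⁻²`,
which decays like `exp (-2t)`. This finiteness later ensures that the Bochner integrals in the
energy do not take their default value. -/
theorem lintegral_besselK0_lt_top {c : ℝ} (hc : 0 < c) :
    ∫⁻ z : Plane, ENNReal.ofReal (besselK0 (c * ‖z‖)) < ∞ := by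
  set C := ∫⁻ z : Plane, ENNReal.ofReal (Real.exp (-‖z‖)) with hC
  have h1 : ∀ z : Plane, ENNReal.ofReal (besselK0 (c * ‖z‖)) ≤
      ∫⁻ t in Ioi (0 : ℝ), ENNReal.ofReal (Real.exp (-(c * ‖z‖) * Real.cosh t)) := by
    intro z
    rw [besselK0, integral_eq_lintegral_of_nonneg_ae
      (Eventually.of_forall fun _ => (Real.exp_pos _).le)
      (Continuous.aestronglyMeasurable (by fun_prop))]
    exact ENNReal.ofReal_toReal_le
  have h2 : ∀ t : ℝ, ∫⁻ z : Plane, ENNReal.ofReal (Real.exp (-(c * ‖z‖) * Real.cosh t)) ≤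
      ENNReal.ofReal (4 / c ^ 2 * Real.exp (-2 * t)) * C := by
    intro t
    have hr : 0 < c * Real.cosh t := mul_pos hc (Real.cosh_pos t)
    have : ∀ z : Plane, ENNReal.ofReal (Real.exp (-(c * ‖z‖) * Real.cosh t)) =
        (fun z : Plane => ENNReal.ofReal (Real.exp (-‖z‖))) ((c * Real.cosh t) • z) := by
      intro z
      simp only [norm_smul, Real.norm_of_nonneg hr.le]
      congr 2
      ring
    rw [lintegral_congr this, lintegral_comp_smul_plane
      (fun z : Plane => ENNReal.ofReal (Real.exp (-‖z‖))) (by fun_prop) hr]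
    gcongr
    have h3 : Real.exp t / 2 ≤ Real.cosh t := by
      rw [Real.cosh_eq]
      linarith [Real.exp_pos (-t)]
    have h4 : (c * (Real.exp t / 2)) ^ 2 ≤ (c * Real.cosh t) ^ 2 := by gcongr
    calc ((c * Real.cosh t) ^ 2)⁻¹ ≤ ((c * (Real.exp t / 2)) ^ 2)⁻¹ :=
          inv_anti₀ (by positivity) h4
      _ = 4 / c ^ 2 * Real.exp (-2 * t) := by
        rw [show -2 * t = -(t + t) by ring, Real.exp_neg, Real.exp_add]
        field_simp
        norm_num
  calc ∫⁻ z : Plane, ENNReal.ofReal (besselK0 (c * ‖z‖))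
      ≤ ∫⁻ z : Plane, ∫⁻ t in Ioi (0 : ℝ),
          ENNReal.ofReal (Real.exp (-(c * ‖z‖) * Real.cosh t)) := lintegral_mono h1
    _ = ∫⁻ t in Ioi (0 : ℝ), ∫⁻ z : Plane,
          ENNReal.ofReal (Real.exp (-(c * ‖z‖) * Real.cosh t)) := by
        apply lintegral_lintegral_swap
        apply Measurable.aemeasurable
        apply Measurable.ennreal_ofReal
        apply Continuous.measurable
        fun_prop
    _ ≤ ∫⁻ t in Ioi (0 : ℝ), ENNReal.ofReal (4 / c ^ 2 * Real.exp (-2 * t)) * C :=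
        lintegral_mono fun t => h2 t
    _ = (∫⁻ t in Ioi (0 : ℝ), ENNReal.ofReal (4 / c ^ 2 * Real.exp (-2 * t))) * C :=
        lintegral_mul_const _ (by fun_prop)
    _ < ∞ := by
        refine ENNReal.mul_lt_top ?_ lintegral_exp_neg_norm_lt_top
        exact ((exp_neg_integrableOn_Ioi 0 (b := 2) (by norm_num)).const_mul _).lintegral_lt_top

/-! ### Periodisation of subsets of the cell -/

/-- The vector of the lattice `L ℤ²` with integer coordinates `n`. -/
noncomputable def latticeVec (L : ℝ) (n : ℤ × ℤ) : Plane := !₂[L * n.1, L * n.2]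

/-- The `L ℤ²`-periodic extension of a set. -/
noncomputable def periodize (L : ℝ) (A : Set Plane) : Set Plane := ⋃ n, {y | y - latticeVec L n ∈ A}

theorem measurableSet_translate {A : Set Plane} (hA : MeasurableSet A) (v : Plane) :
    MeasurableSet {y | y - v ∈ A} := (measurable_id.sub_const v) hA

theorem measurableSet_periodize {A : Set Plane} (hA : MeasurableSet A) (L : ℝ) :
    MeasurableSet (periodize L A) :=
  MeasurableSet.iUnion fun _ => measurableSet_translate hA _

theorem subset_periodize (L : ℝ) (A : Set Plane) : A ⊆ periodize L A := by
  intro x hx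
  refine mem_iUnion.2 ⟨0, ?_⟩
  have : latticeVec L 0 = 0 := by
    ext i; fin_cases i <;> simp [latticeVec]
  simpa [this] using hx

theorem latticeVec_add (L : ℝ) (m n : ℤ × ℤ) :
    latticeVec L (m + n) = latticeVec L m + latticeVec L n := by
  ext i; fin_cases i <;> simp [latticeVec, mul_add]

theorem single_eq_latticeVec (L : ℝ) (i : Fin 2) :
    ∃ n, EuclideanSpace.single i L = latticeVec L n := by
  fin_cases i
  · exact ⟨(1, 0), by ext j; fin_cases j <;> simp [latticeVec]⟩
  · exact ⟨(0, 1), by ext j; fin_cases j <;> simp [latticeVec]⟩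

theorem add_single_mem_periodize_iff (L : ℝ) (A : Set Plane) (y : Plane) (i : Fin 2) :
    y + EuclideanSpace.single i L ∈ periodize L A ↔ y ∈ periodize L A := by
  obtain ⟨m, hm⟩ := single_eq_latticeVec L i
  rw [hm]
  simp only [periodize, mem_iUnion, mem_ofPred_eq]
  constructor
  · rintro ⟨n, hn⟩
    refine ⟨n - m, ?_⟩
    have : latticeVec L n = latticeVec L (n - m) + latticeVec L m := by
      rw [← latticeVec_add, sub_add_cancel]
    rw [this] at hn
    convert hn using 1
    abel
  · rintro ⟨n, hn⟩
    refine ⟨n + m, ?_⟩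
    rw [latticeVec_add]
    convert hn using 1
    abel

theorem disjoint_translates {L : ℝ} (hL : 0 < L) {A : Set Plane} (hA : A ⊆ torusCell L) :
    Pairwise (Function.onFun Disjoint fun n => {y | y - latticeVec L n ∈ A}) := by
  have key : ∀ (a : ℝ) (m n : ℤ), a - L * m ∈ Ico 0 L → a - L * n ∈ Ico 0 L → m = n := by
    rintro a m n ⟨h1, h2⟩ ⟨h3, h4⟩
    have h5 : L * ((m : ℝ) - n) < L * 1 := by linarith
    have h6 : L * ((n : ℝ) - m) < L * 1 := by linarith
    have h7 := lt_of_mul_lt_mul_left h5 hL.le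
    have h8 := lt_of_mul_lt_mul_left h6 hL.le
    have h9 : m - n < 1 := by exact_mod_cast h7
    have h10 : n - m < 1 := by exact_mod_cast h8
    omega
  intro m n hmn
  refine Set.disjoint_left.2 fun y hm hn => hmn ?_
  have h1 := hA hm
  have h2 := hA hn
  apply Prod.ext
  · exact key (y 0) _ _ (by simpa [latticeVec] using h1 0) (by simpa [latticeVec] using h2 0)
  · exact key (y 1) _ _ (by simpa [latticeVec] using h1 1) (by simpa [latticeVec] using h2 1)

/-- Unfolding: it trades the lattice sum in the torus kernel for the full-plane kernel integrated
over the periodic set. -/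
theorem tsum_lintegral_translate {L : ℝ} (hL : 0 < L) {A : Set Plane} (hA : A ⊆ torusCell L)
    (hAm : MeasurableSet A) (f : Plane → ℝ≥0∞) :
    ∑' n, ∫⁻ y in A, f (y + latticeVec L n) = ∫⁻ y in periodize L A, f y := by
  rw [periodize, lintegral_iUnion (fun n => measurableSet_translate hAm _)
    (disjoint_translates hL hA)]
  congr 1
  ext n
  have h : {y | y - latticeVec L n ∈ A} = (fun y => y - latticeVec L n) ⁻¹' A := rfl
  have hmp := measurePreserving_sub_right (volume : Measure Plane) (latticeVec L n)
  have he : MeasurableEmbedding (fun y : Plane => y - latticeVec L n) :=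
    (MeasurableEquiv.subRight (latticeVec L n)).measurableEmbedding
  rw [h, ← hmp.setLIntegral_comp_preimage_emb he]
  simp

theorem isBounded_of_subset_torusCell {L : ℝ} {A : Set Plane} (hA : A ⊆ torusCell L) :
    Bornology.IsBounded A := by
  rw [isBounded_iff_forall_norm_le]
  refine ⟨Real.sqrt (L ^ 2 + L ^ 2), fun x hx => ?_⟩
  rw [EuclideanSpace.norm_eq]
  apply Real.sqrt_le_sqrt
  have h0 := hA hx 0
  have h1 := hA hx 1
  simp only [Fin.sum_univ_two, Real.norm_eq_abs, sq_abs]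
  have := h0.1; have := h0.2; have := h1.1; have := h1.2
  gcongr

theorem measure_lt_top_of_subset_torusCell {L : ℝ} {A : Set Plane} (hA : A ⊆ torusCell L) :
    volume A < ∞ :=
  (isBounded_of_subset_torusCell hA).measure_lt_top

/-! ### The interaction energy -/

/-- The screened kernel without its prefactor, with values in `[0, ∞]`. -/
noncomputable def kernelSum (κ : ℝ) (x : Plane) : ℝ≥0∞ :=
  ∑' n : ℤ × ℤ, ENNReal.ofReal (besselK0 (κ * ‖x - !₂[(n.1 : ℝ), (n.2 : ℝ)]‖))

theorem measurable_kernelSum (κ : ℝ) : Measurable (kernelSum κ) := by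
  apply Measurable.tsum
  intro n
  exact (measurable_besselK0.comp (by fun_prop)).ennreal_ofReal

/-- Valid at every `x`: where the sum diverges, both the real `tsum` and `toReal ⊤` are zero. -/
theorem screenedKernel_eq (κ : ℝ) (x : Plane) :
    screenedKernel κ x = 1 / (2 * Real.pi) * (kernelSum κ x).toReal := by
  rw [screenedKernel, kernelSum, ENNReal.tsum_toReal_eq (fun _ => ofReal_ne_top)]
  simp [besselK0_nonneg]

theorem lintegral_kernelSum {κ l : ℝ} (hl : 0 < l) {A : Set Plane}
    (hA : A ⊆ torusCell l⁻¹) (hAm : MeasurableSet A) (x : Plane) :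
    ∫⁻ y in A, kernelSum κ (l • (x - y)) =
      ∫⁻ y in periodize l⁻¹ A, ENNReal.ofReal (besselK0 (κ * l * ‖x - y‖)) := by
  rw [← tsum_lintegral_translate (inv_pos.2 hl) hA hAm]
  simp only [kernelSum]
  rw [lintegral_tsum]
  · congr 1
    ext n
    apply lintegral_congr
    intro y
    congr 2
    have : l • (x - y) - !₂[(n.1 : ℝ), (n.2 : ℝ)] = l • (x - (y + latticeVec l⁻¹ n)) := by
      ext i
      fin_cases i <;> simp [latticeVec] <;> field_simp <;> ring
    rw [this, norm_smul, Real.norm_of_nonneg hl.le, mul_assoc]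
  · intro n
    exact (measurable_besselK0.comp (by fun_prop)).ennreal_ofReal.aemeasurable

/-- The interaction energy of a subset of the cell, as an integral over its periodic extension. -/
theorem interaction_eq {κ l : ℝ} (hκ : 0 < κ) (hl : 0 < l) {A : Set Plane}
    (hA : A ⊆ torusCell l⁻¹) (hAm : MeasurableSet A) :
    (∫ x in A, ∫ y in A, screenedKernel κ (l • (x - y)) = 1 / (2 * Real.pi) *
      (∫⁻ x in A, ∫⁻ y in periodize l⁻¹ A,
        ENNReal.ofReal (besselK0 (κ * l * ‖x - y‖))).toReal) ∧
    ∫⁻ x in A, ∫⁻ y in periodize l⁻¹ A,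
        ENNReal.ofReal (besselK0 (κ * l * ‖x - y‖)) < ∞ := by
  set C := ∫⁻ z : Plane, ENNReal.ofReal (besselK0 (κ * l * ‖z‖)) with hC
  have hCtop : C < ∞ := lintegral_besselK0_lt_top (mul_pos hκ hl)
  set I : Plane → ℝ≥0∞ := fun x => ∫⁻ y in periodize l⁻¹ A,
    ENNReal.ofReal (besselK0 (κ * l * ‖x - y‖)) with hI
  have hIle : ∀ x, I x ≤ C := by
    intro x
    calc I x ≤ ∫⁻ y, ENNReal.ofReal (besselK0 (κ * l * ‖x - y‖)) := setLIntegral_le_lintegral _ _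
      _ = C := by
        exact lintegral_sub_left_eq_self (fun z => ENNReal.ofReal (besselK0 (κ * l * ‖z‖))) x
  have hImeas : Measurable I := by
    apply Measurable.lintegral_prod_right' (f := fun p : Plane × Plane =>
      ENNReal.ofReal (besselK0 (κ * l * ‖p.1 - p.2‖)))
    exact (measurable_besselK0.comp (by fun_prop)).ennreal_ofReal
  have hinner : ∀ x, ∫ y in A, screenedKernel κ (l • (x - y)) =
      1 / (2 * Real.pi) * (I x).toReal := by
    intro x
    simp_rw [screenedKernel_eq]
    rw [integral_const_mul]
    congr 1
    have hm : Measurable fun y : Plane => kernelSum κ (l • (x - y)) :=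
      (measurable_kernelSum κ).comp (by fun_prop)
    rw [integral_toReal hm.aemeasurable]
    · rw [lintegral_kernelSum hl hA hAm]
    · apply ae_lt_top hm
      rw [lintegral_kernelSum hl hA hAm]
      exact ((hIle x).trans_lt hCtop).ne
  constructor
  · simp_rw [hinner]
    rw [integral_const_mul, integral_toReal hImeas.aemeasurable]
    exact Eventually.of_forall fun x => (hIle x).trans_lt hCtop
  · calc ∫⁻ x in A, I x ≤ ∫⁻ _ in A, C := lintegral_mono hIle
      _ = C * volume A := by simp
      _ < ∞ := ENNReal.mul_lt_top hCtop (measure_lt_top_of_subset_torusCell hA)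

theorem integrable_measureReal_inter_ball {A S : Set Plane} (hA : volume A < ∞)
    (hS : MeasurableSet S) (ρ : ℝ) :
    IntegrableOn (fun x => volume.real (S ∩ Metric.ball x ρ)) A := by
  have hm : Measurable fun x => volume (S ∩ Metric.ball x ρ) := by
    have h : MeasurableSet {p : Plane × Plane | p.2 ∈ S ∧ dist p.2 p.1 < ρ} :=
      (measurable_snd hS).inter
        (measurableSet_lt (measurable_snd.dist measurable_fst) measurable_const)
    exact measurable_measure_prodMk_left h
  refine Measure.integrableOn_of_bounded (M := volume.real (Metric.ball (0 : Plane) ρ)) hA.ne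
    hm.ennreal_toReal.aestronglyMeasurable (Eventually.of_forall fun x => ?_)
  rw [Real.norm_of_nonneg measureReal_nonneg, ← Measure.addHaar_real_ball_center volume x]
  exact measureReal_mono inter_subset_right measure_ball_lt_top.ne

/-- If the kernel is bounded below by `c` up to distance `ρ`, the interaction energy is bounded
below by the mean area of the set in discs of radius `ρ`. -/
theorem interaction_ge {κ l ρ c : ℝ} (hκ : 0 < κ) (hl : 0 < l) (hc : 0 ≤ c) {A : Set Plane}
    (hA : A ⊆ torusCell l⁻¹) (hAm : MeasurableSet A)
    (hK : ∀ s, 0 < s → s < ρ → c ≤ besselK0 (κ * l * s)) :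
    c / (2 * Real.pi) * ∫ x in A, volume.real (periodize l⁻¹ A ∩ Metric.ball x ρ) ≤
      ∫ x in A, ∫ y in A, screenedKernel κ (l • (x - y)) := by
  obtain ⟨heq, hlt⟩ := interaction_eq hκ hl hA hAm
  set S := periodize l⁻¹ A with hS
  have hSm : MeasurableSet S := measurableSet_periodize hAm _
  rw [heq, div_mul_eq_mul_div, div_mul_eq_mul_div, one_mul]
  gcongr
  have hfin : ∀ x, volume (S ∩ Metric.ball x ρ) < ∞ := fun x =>
    (measure_mono inter_subset_right).trans_lt measure_ball_lt_top
  rw [← ENNReal.ofReal_le_iff_le_toReal hlt.ne, ENNReal.ofReal_mul hc,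
    ofReal_integral_eq_lintegral_ofReal
      (integrable_measureReal_inter_ball (measure_lt_top_of_subset_torusCell hA) hSm ρ)
      (Eventually.of_forall fun _ => measureReal_nonneg),
    ← lintegral_const_mul' _ _ ofReal_ne_top]
  apply lintegral_mono
  intro x
  simp only
  rw [ofReal_measureReal (hfin x).ne]
  calc ENNReal.ofReal c * volume (S ∩ Metric.ball x ρ)
      = ∫⁻ y in S ∩ Metric.ball x ρ, ENNReal.ofReal c := by simp
    _ ≤ ∫⁻ y in S ∩ Metric.ball x ρ, ENNReal.ofReal (besselK0 (κ * l * ‖x - y‖)) := by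
        apply lintegral_mono_ae
        -- The diagonal must be excluded: `besselK0 0` is the integral of a non-integrable function,
        -- hence `0` by default.
        have hne : ∀ᵐ y : Plane ∂(volume.restrict (S ∩ Metric.ball x ρ)), y ≠ x :=
          ae_restrict_of_ae (Measure.ae_ne volume x)
        filter_upwards [ae_restrict_mem (hSm.inter measurableSet_ball), hne] with y hy hyx
        apply ENNReal.ofReal_le_ofReal
        apply hK _ (norm_pos_iff.2 (sub_ne_zero.2 hyx.symm))
        have := hy.2
        rwa [Metric.mem_ball, dist_comm, dist_eq_norm] at this
    _ ≤ ∫⁻ y in S, ENNReal.ofReal (besselK0 (κ * l * ‖x - y‖)) :=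
        lintegral_mono_set inter_subset_left

/-! ### The extremal set for the Newtonian field -/

/-- The radial integral in polar coordinates: the Jacobian `r` turns `(cos θ / r - lam)₊` into `(cos
θ - lam * r)₊`, a triangle of area `(cos θ)₊² / (2 * lam)`. -/
theorem lintegral_ofReal_sub_mul_le {lam : ℝ} (hlam : 0 < lam) (c : ℝ) :
    ∫⁻ r in Ioi (0 : ℝ), ENNReal.ofReal (c - lam * r) ≤
      ENNReal.ofReal (max c 0 ^ 2 / (2 * lam)) := by
  rcases le_or_gt c 0 with hc | hc
  · have : ∫⁻ r in Ioi (0 : ℝ), ENNReal.ofReal (c - lam * r) = 0 := by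
      rw [setLIntegral_congr_fun (g := fun _ => 0) measurableSet_Ioi]
      · simp
      · intro r hr
        apply ENNReal.ofReal_of_nonpos
        have : 0 < lam * r := mul_pos hlam hr
        linarith
    rw [this]
    exact bot_le
  · have hb : 0 ≤ c / lam := by positivity
    have h1 : ∫⁻ r in Ioi (0 : ℝ), ENNReal.ofReal (c - lam * r) ≤
        ∫⁻ r in Ioc 0 (c / lam), ENNReal.ofReal (c - lam * r) := by
      rw [← lintegral_indicator measurableSet_Ioi, ← lintegral_indicator measurableSet_Ioc]
      apply lintegral_mono
      intro r
      by_cases hr : r ∈ Ioc 0 (c / lam)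
      · simp [hr, hr.1]
      · by_cases hr0 : 0 < r
        · have : c / lam < r := by
            by_contra h
            exact hr ⟨hr0, not_lt.1 h⟩
          have h2 : c < lam * r := by
            rw [div_lt_iff₀ hlam] at this
            linarith
          simp [hr0, ENNReal.ofReal_of_nonpos (sub_nonpos.2 h2.le)]
        · simp [hr0]
    refine h1.trans ?_
    have hint : IntegrableOn (fun r : ℝ => c - lam * r) (Ioc 0 (c / lam)) :=
      (Continuous.integrableOn_Icc (by fun_prop)).mono_set Ioc_subset_Icc_self
    rw [← ofReal_integral_eq_lintegral_ofReal hint, ← intervalIntegral.integral_of_le hb]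
    · apply ENNReal.ofReal_le_ofReal
      rw [intervalIntegral.integral_sub (by simp)
        (Continuous.intervalIntegrable (by fun_prop) _ _), intervalIntegral.integral_const_mul,
        integral_id, max_eq_left hc.le]
      apply le_of_eq
      simp
      field_simp
      ring
    · filter_upwards [ae_restrict_mem measurableSet_Ioc] with r hr
      have := hr.2
      rw [le_div_iff₀ hlam] at this
      simp only [Pi.zero_apply]
      linarith

theorem lintegral_max_cos_sq_le {lam : ℝ} (hlam : 0 < lam) :
    ∫⁻ θ in Ioo (-Real.pi) Real.pi, ENNReal.ofReal (max (Real.cos θ) 0 ^ 2 / (2 * lam)) ≤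
      ENNReal.ofReal (Real.pi / (4 * lam)) := by
  have hpi := Real.pi_pos
  have h1 : ∫⁻ θ in Ioo (-Real.pi) Real.pi, ENNReal.ofReal (max (Real.cos θ) 0 ^ 2 / (2 * lam)) ≤
      ∫⁻ θ in Ioc (-(Real.pi / 2)) (Real.pi / 2),
        ENNReal.ofReal (Real.cos θ ^ 2 / (2 * lam)) := by
    rw [← lintegral_indicator measurableSet_Ioo, ← lintegral_indicator measurableSet_Ioc]
    apply lintegral_mono
    intro θ
    by_cases hθ : θ ∈ Ioc (-(Real.pi / 2)) (Real.pi / 2)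
    · have hθ' : θ ∈ Ioo (-Real.pi) Real.pi := ⟨by linarith [hθ.1], by linarith [hθ.2]⟩
      have hc : 0 ≤ Real.cos θ := Real.cos_nonneg_of_mem_Icc ⟨hθ.1.le, hθ.2⟩
      simp [hθ, hθ', max_eq_left hc]
    · by_cases hθ' : θ ∈ Ioo (-Real.pi) Real.pi
      · have hc : Real.cos θ ≤ 0 := by
          rcases le_or_gt θ (-(Real.pi / 2)) with h | h
          · rw [← Real.cos_neg]
            exact Real.cos_nonpos_of_pi_div_two_le_of_le (by linarith) (by linarith [hθ'.1])
          · have h' : Real.pi / 2 < θ := by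
              by_contra h''
              exact hθ ⟨h, not_lt.1 h''⟩
            exact Real.cos_nonpos_of_pi_div_two_le_of_le h'.le (by linarith [hθ'.2])
        simp [hθ', max_eq_right hc]
      · simp [hθ']
  refine h1.trans ?_
  have hcont : Continuous fun θ : ℝ => Real.cos θ ^ 2 / (2 * lam) := by fun_prop
  rw [← ofReal_integral_eq_lintegral_ofReal
    (hcont.integrableOn_Icc.mono_set Ioc_subset_Icc_self)
    (Eventually.of_forall fun θ => by positivity),
    ← intervalIntegral.integral_of_le (by linarith)]
  apply ENNReal.ofReal_le_ofReal
  rw [intervalIntegral.integral_div, integral_cos_sq]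
  apply le_of_eq
  simp
  field_simp
  ring

theorem lintegral_complex_re_div_sub_le {lam : ℝ} (hlam : 0 < lam) :
    ∫⁻ z : ℂ, ENNReal.ofReal (z.re / ‖z‖ ^ 2 - lam) ≤ ENNReal.ofReal (Real.pi / (4 * lam)) := by
  rw [← Complex.lintegral_comp_polarCoord_symm]
  calc ∫⁻ p in polarCoord.target, ENNReal.ofReal p.1 •
        ENNReal.ofReal ((Complex.polarCoord.symm p).re / ‖Complex.polarCoord.symm p‖ ^ 2 - lam)
      = ∫⁻ p in polarCoord.target, ENNReal.ofReal (Real.cos p.2 - lam * p.1) := by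
        apply setLIntegral_congr_fun polarCoord.open_target.measurableSet
        intro p hp
        rw [polarCoord_target] at hp
        have hp1 : 0 < p.1 := hp.1
        simp only [smul_eq_mul]
        rw [← ENNReal.ofReal_mul hp1.le, Complex.norm_polarCoord_symm, abs_of_pos hp1,
          Complex.polarCoord_symm_apply]
        congr 1
        simp only [Complex.mul_re, Complex.ofReal_re, Complex.ofReal_im, Complex.add_re,
          Complex.I_re, Complex.I_im, Complex.add_im, Complex.mul_im, zero_mul, sub_zero]
        field_simp
        ring
    _ = ∫⁻ p in Ioi (0 : ℝ) ×ˢ Ioo (-Real.pi) Real.pi,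
          ENNReal.ofReal (Real.cos p.2 - lam * p.1) := by rw [polarCoord_target]
    _ = ∫⁻ θ in Ioo (-Real.pi) Real.pi, ∫⁻ r in Ioi (0 : ℝ),
          ENNReal.ofReal (Real.cos θ - lam * r) := by
        rw [Measure.volume_eq_prod, ← Measure.prod_restrict, lintegral_prod_symm]
        exact Measurable.aemeasurable (by fun_prop)
    _ ≤ ∫⁻ θ in Ioo (-Real.pi) Real.pi, ENNReal.ofReal (max (Real.cos θ) 0 ^ 2 / (2 * lam)) :=
        lintegral_mono fun θ => lintegral_ofReal_sub_mul_le hlam _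
    _ ≤ _ := lintegral_max_cos_sq_le hlam

theorem exists_linearIsometryEquiv_map_one {e : Plane} (he : ‖e‖ = 1) :
    ∃ T : ℂ ≃ₗᵢ[ℝ] Plane, T 1 = e := by
  have hv : Orthonormal ℝ (({0} : Set (Fin 2)).domRestrict fun _ => e) := by
    constructor
    · intro i
      exact he
    · intro i j hij
      exact absurd (Subsingleton.elim i j) hij
  obtain ⟨b, hb⟩ := hv.exists_orthonormalBasis_extension_of_card_eq (by simp)
  refine ⟨Complex.orthonormalBasisOneI.equiv b (Equiv.refl _), ?_⟩
  have h := Complex.orthonormalBasisOneI.equiv_apply_basis b (Equiv.refl _) 0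
  simp only [Equiv.refl_apply, hb 0 rfl] at h
  rw [← h]
  simp

/-- The region where the integrand is positive is a disc of radius `1 / (2 * lam)` with the origin
on its boundary. This is the extremal set that makes the field bound sharp. A rotation reduces it to
the computation in `ℂ`. -/
theorem lintegral_inner_div_sub_le {lam : ℝ} (hlam : 0 < lam) {e : Plane} (he : ‖e‖ = 1) :
    ∫⁻ z : Plane, ENNReal.ofReal (inner ℝ e z / ‖z‖ ^ 2 - lam) ≤
      ENNReal.ofReal (Real.pi / (4 * lam)) := by
  obtain ⟨T, hT⟩ := exists_linearIsometryEquiv_map_one he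
  refine le_trans (le_of_eq ?_) (lintegral_complex_re_div_sub_le hlam)
  rw [← T.measurePreserving.lintegral_comp_emb T.toHomeomorph.measurableEmbedding]
  apply lintegral_congr
  intro z
  rw [← hT, T.inner_map_map, T.norm_map]
  simp

/-- The bathtub principle in pointwise form: `a * w ≤ (w - lam)₊ + lam * a` for `a ∈ [0, 1]`. The
regularisation `η` only shrinks `w` where `w` is positive. -/
theorem inner_div_le_max_add {lam : ℝ} {e z : Plane} {a η : ℝ} (ha0 : 0 ≤ a)
    (ha1 : a ≤ 1) (hη : 0 < η) (hlam : 0 < lam) :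
    a / (‖z‖ ^ 2 + η) * inner ℝ e z ≤ max (inner ℝ e z / ‖z‖ ^ 2 - lam) 0 + lam * a := by
  have hmax := le_max_right (inner ℝ e z / ‖z‖ ^ 2 - lam) 0
  rcases le_or_gt (inner ℝ e z) 0 with h | h
  · have h1 : a / (‖z‖ ^ 2 + η) * inner ℝ e z ≤ 0 :=
      mul_nonpos_of_nonneg_of_nonpos (by positivity) h
    have h2 : 0 ≤ lam * a := by positivity
    linarith
  · have hz : 0 < ‖z‖ := by
      rw [norm_pos_iff]
      rintro rfl
      simp at h
    calc a / (‖z‖ ^ 2 + η) * inner ℝ e z ≤ a / (‖z‖ ^ 2) * inner ℝ e z := by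
          gcongr
          linarith
      _ = a * (inner ℝ e z / ‖z‖ ^ 2 - lam) + lam * a := by ring
      _ ≤ a * max (inner ℝ e z / ‖z‖ ^ 2 - lam) 0 + lam * a := by
          gcongr
          exact le_max_left _ _
      _ ≤ 1 * max (inner ℝ e z / ‖z‖ ^ 2 - lam) 0 + lam * a := by gcongr
      _ = _ := by ring

theorem integrable_max_inner_div_sub {lam : ℝ} (hlam : 0 < lam) {e : Plane} (he : ‖e‖ = 1) :
    Integrable (fun z : Plane => max (inner ℝ e z / ‖z‖ ^ 2 - lam) 0) ∧
      ∫ z : Plane, max (inner ℝ e z / ‖z‖ ^ 2 - lam) 0 ≤ Real.pi / (4 * lam) := by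
  have hle := lintegral_inner_div_sub_le hlam he
  have hm : Measurable (fun z : Plane => max (inner ℝ e z / ‖z‖ ^ 2 - lam) 0) := by fun_prop
  have hof : ∀ z : Plane, ENNReal.ofReal (max (inner ℝ e z / ‖z‖ ^ 2 - lam) 0) =
      ENNReal.ofReal (inner ℝ e z / ‖z‖ ^ 2 - lam) := fun z => by
    rw [ENNReal.ofReal_max]; simp
  constructor
  · rw [← lintegral_ofReal_ne_top_iff_integrable hm.aestronglyMeasurable
      (Eventually.of_forall fun z => le_max_right _ _)]
    simp_rw [hof]
    exact (hle.trans_lt ofReal_lt_top).ne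
  · have h0 : 0 ≤ fun z : Plane => max (inner ℝ e z / ‖z‖ ^ 2 - lam) 0 :=
      fun z => le_max_right _ _
    rw [integral_eq_lintegral_of_nonneg_ae (Eventually.of_forall h0)
      hm.aestronglyMeasurable]
    simp_rw [hof]
    exact ENNReal.toReal_le_of_le_ofReal (by have := Real.pi_pos; positivity) hle

/-- The sharp bound on the regularised Newtonian field of a density `g ∈ [0, 1]`. -/
theorem norm_integral_newtonian_le {R η : ℝ} (hR : 0 < R) (hη : 0 < η) {g : Plane → ℝ}
    (hg0 : ∀ y, 0 ≤ g y) (hg1 : ∀ y, g y ≤ 1) (hg : Integrable g) (x : Plane) :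
    ‖∫ y, (g y / (‖x - y‖ ^ 2 + η)) • (x - y)‖ ≤
      Real.pi * R / 2 + (∫ y, g y) / (2 * R) := by
  set V := ∫ y, (g y / (‖x - y‖ ^ 2 + η)) • (x - y) with hV
  have hpi := Real.pi_pos
  have hB : 0 ≤ Real.pi * R / 2 + (∫ y, g y) / (2 * R) := by
    have : 0 ≤ ∫ y, g y := integral_nonneg hg0
    positivity
  rcases eq_or_ne V 0 with h0 | h0
  · rw [h0, norm_zero]
    exact hB
  have hV0 : 0 < ‖V‖ := norm_pos_iff.2 h0
  set e := ‖V‖⁻¹ • V with he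
  have he1 : ‖e‖ = 1 := by
    rw [he, norm_smul, norm_inv, norm_norm, inv_mul_cancel₀ hV0.ne']
  have heV : inner ℝ e V = ‖V‖ := by
    rw [he, real_inner_smul_left, real_inner_self_eq_norm_sq]
    field_simp
  have hint : Integrable fun y => (g y / (‖x - y‖ ^ 2 + η)) • (x - y) := by
    refine Integrable.mono' (hg.mul_const (1 + 1 / η)) ?_ ?_
    · have h1 : AEStronglyMeasurable (fun y => g y / (‖x - y‖ ^ 2 + η)) :=
        (hg.aemeasurable.div (Measurable.aemeasurable (by fun_prop))).aestronglyMeasurable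
      have h2 : AEStronglyMeasurable (fun y : Plane => x - y) :=
        Continuous.aestronglyMeasurable (by fun_prop)
      exact h1.smul h2
    · refine Eventually.of_forall fun y => ?_
      rw [norm_smul, Real.norm_of_nonneg (div_nonneg (hg0 y) (by positivity)), div_mul_eq_mul_div,
        mul_div_assoc]
      gcongr
      · exact hg0 y
      · rw [div_le_iff₀ (by positivity)]
        have h1 : ‖x - y‖ ≤ 1 + ‖x - y‖ ^ 2 := by nlinarith [sq_nonneg (‖x - y‖ - 1)]
        have h2 : 0 ≤ 1 / η * ‖x - y‖ ^ 2 := by positivity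
        have h3 : 1 / η * η = 1 := by field_simp
        nlinarith
  -- This multiplier makes the extremal disc have radius exactly `R`.
  have hlam : (0 : ℝ) < 1 / (2 * R) := by positivity
  obtain ⟨hi, hle⟩ := integrable_max_inner_div_sub hlam he1
  have hix : Integrable fun y => max (inner ℝ e (x - y) / ‖x - y‖ ^ 2 - 1 / (2 * R)) 0 :=
    hi.comp_sub_left x
  calc ‖V‖ = ∫ y, inner ℝ e ((g y / (‖x - y‖ ^ 2 + η)) • (x - y)) := by
        rw [← heV, hV, ← integral_inner hint]
    _ ≤ ∫ y, (max (inner ℝ e (x - y) / ‖x - y‖ ^ 2 - 1 / (2 * R)) 0 + 1 / (2 * R) * g y) := by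
        apply integral_mono (hint.const_inner e) (hix.add (hg.const_mul _))
        intro y
        simp only [real_inner_smul_right]
        exact inner_div_le_max_add (hg0 y) (hg1 y) hη hlam
    _ = (∫ z : Plane, max (inner ℝ e z / ‖z‖ ^ 2 - 1 / (2 * R)) 0) + 1 / (2 * R) * ∫ y, g y := by
        rw [integral_add hix (hg.const_mul _), integral_const_mul]
        congr 1
        exact integral_sub_left_eq_self
          (fun z => max (inner ℝ e z / ‖z‖ ^ 2 - 1 / (2 * R)) 0) volume x
    _ ≤ Real.pi / (4 * (1 / (2 * R))) + 1 / (2 * R) * ∫ y, g y := by gcongr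
    _ = _ := by
        field_simp
        ring

/-! ### Cutoff functions -/

/-- A `C¹` cutoff function at scale `M` with gradient at most `C / M`. -/
structure IsCutoff (C M : ℝ) (χ : Plane → ℝ) : Prop where
  contDiff : ContDiff ℝ 1 χ
  nonneg : ∀ z, 0 ≤ χ z
  le_one : ∀ z, χ z ≤ 1
  eq_one : ∀ z, ‖z‖ ≤ M → χ z = 1
  eq_zero : ∀ z, 2 * M ≤ ‖z‖ → χ z = 0
  norm_fderiv_le : ∀ z, ‖fderiv ℝ χ z‖ ≤ C / M

theorem exists_isCutoff : ∃ C : ℝ, 0 ≤ C ∧ ∀ M : ℝ, 0 < M → ∃ χ, IsCutoff C M χ := by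
  let f : ContDiffBump (0 : Plane) := ⟨1, 2, by norm_num, by norm_num⟩
  have hf : ContDiff ℝ 1 f := f.contDiff
  obtain ⟨C, hC⟩ := (hf.continuous_fderiv one_ne_zero).bounded_above_of_compact_support
    (f.hasCompactSupport.fderiv ℝ)
  refine ⟨C, (norm_nonneg _).trans (hC 0), fun M hM => ⟨fun z => f (M⁻¹ • z), ?_⟩⟩
  have hnorm : ∀ z : Plane, ‖M⁻¹ • z‖ = ‖z‖ / M := fun z => by
    rw [norm_smul, Real.norm_of_nonneg (inv_nonneg.2 hM.le), inv_mul_eq_div]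
  refine ⟨hf.comp (contDiff_const_smul _), fun z => f.nonneg, fun z => f.le_one, ?_, ?_, ?_⟩
  · intro z hz
    apply f.one_of_mem_closedBall
    rw [mem_closedBall_zero_iff, hnorm, div_le_iff₀ hM]
    simpa [f] using hz
  · intro z hz
    apply f.zero_of_le_dist
    rw [dist_zero_right, hnorm, le_div_iff₀ hM]
    simpa [f] using hz
  · intro z
    have h : HasFDerivAt (fun z : Plane => f (M⁻¹ • z))
        ((fderiv ℝ f (M⁻¹ • z)).comp (M⁻¹ • ContinuousLinearMap.id ℝ Plane)) z := by
      apply HasFDerivAt.comp z (hf.differentiable one_ne_zero _).hasFDerivAt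
      exact (hasFDerivAt_id z).const_smul M⁻¹
    rw [h.fderiv]
    have : (fderiv ℝ f (M⁻¹ • z)).comp (M⁻¹ • ContinuousLinearMap.id ℝ Plane) =
        M⁻¹ • fderiv ℝ f (M⁻¹ • z) := by
      ext v; simp
    rw [this, norm_smul, Real.norm_of_nonneg (inv_nonneg.2 hM.le), inv_mul_eq_div]
    gcongr
    exact hC _

namespace IsCutoff

variable {C M : ℝ} {χ : Plane → ℝ}

theorem hasCompactSupport (h : IsCutoff C M χ) : HasCompactSupport χ := by
  refine HasCompactSupport.intro (isCompact_closedBall (0 : Plane) (2 * M)) fun z hz => ?_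
  apply h.eq_zero
  rw [mem_closedBall_zero_iff, not_le] at hz
  exact hz.le

theorem fderiv_eq_zero_of_norm_lt (h : IsCutoff C M χ) {z : Plane} (hz : ‖z‖ < M) :
    fderiv ℝ χ z = 0 := by
  have : χ =ᶠ[𝓝 z] fun _ => 1 := by
    filter_upwards [continuous_norm.continuousAt.eventually_lt continuousAt_const hz] with y hy
    exact h.eq_one y hy.le
  rw [this.fderiv_eq]
  simp

theorem fderiv_eq_zero_of_lt_norm (h : IsCutoff C M χ) {z : Plane} (hz : 2 * M < ‖z‖) :
    fderiv ℝ χ z = 0 := by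
  have : χ =ᶠ[𝓝 z] fun _ => 0 := by
    filter_upwards [continuousAt_const.eventually_lt continuous_norm.continuousAt hz] with y hy
    exact h.eq_zero y hy.le
  rw [this.fderiv_eq]
  simp

/-- The radius `3 * M` instead of `2 * M` leaves room for an open ball, the form in which
`interaction_ge` measures local area. -/
theorem norm_fderiv_le_indicator (h : IsCutoff C M χ) (hM : 0 < M) (z : Plane) :
    ‖fderiv ℝ χ z‖ ≤ (Metric.ball (0 : Plane) (3 * M)).indicator (fun _ => C / M) z := by
  by_cases hz : ‖z‖ < 3 * M
  · rw [indicator_of_mem (by simpa using hz)]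
    exact h.norm_fderiv_le z
  · rw [indicator_of_notMem (by simpa using hz), h.fderiv_eq_zero_of_lt_norm (by linarith)]
    simp

theorem le_indicator (h : IsCutoff C M χ) (hM : 0 < M) (z : Plane) :
    χ z ≤ (Metric.ball (0 : Plane) (3 * M)).indicator (fun _ => 1) z := by
  by_cases hz : ‖z‖ < 3 * M
  · rw [indicator_of_mem (by simpa using hz)]
    exact h.le_one z
  · rw [indicator_of_notMem (by simpa using hz), h.eq_zero _ (by linarith)]

end IsCutoff

/-! ### Divergence -/

theorem sum_apply_single_mul (T : Plane →L[ℝ] ℝ) (v : Plane) :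
    ∑ i, T (EuclideanSpace.single i 1) * v i = T v := by
  have hv : v = ∑ i, v i • (EuclideanSpace.single i 1 : Plane) := by
    ext j
    fin_cases j <;> simp
  conv_rhs => rw [hv, map_sum]
  simp [mul_comm]

theorem divergence_smul {u : Plane → ℝ} {V : Plane → Plane} {x : Plane}
    (hu : DifferentiableAt ℝ u x) (hV : DifferentiableAt ℝ V x) :
    divergence (fun y => u y • V y) x = u x * divergence V x + fderiv ℝ u x (V x) := by
  rw [divergence, fderiv_fun_smul hu hV]
  rw [← sum_apply_single_mul (fderiv ℝ u x) (V x), divergence, Finset.mul_sum,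
    ← Finset.sum_add_distrib]
  apply Finset.sum_congr rfl
  intro i _
  simp

theorem continuous_divergence {φ : Plane → Plane} (hφ : ContDiff ℝ 1 φ) :
    Continuous (divergence φ) := by
  have h := hφ.continuous_fderiv one_ne_zero
  unfold divergence
  fun_prop

/-- The regularised and truncated Newtonian kernel. -/
noncomputable def newtonKernel (χ : Plane → ℝ) (η : ℝ) (z : Plane) : Plane :=
  (χ z / (‖z‖ ^ 2 + η)) • z

theorem contDiff_newtonKernel {χ : Plane → ℝ} (hχ : ContDiff ℝ 1 χ) {η : ℝ} (hη : 0 < η) :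
    ContDiff ℝ 1 (newtonKernel χ η) := by
  refine ContDiff.smul (hχ.div ((contDiff_norm_sq ℝ).add contDiff_const) fun z => ?_) contDiff_id
  positivity

/-- The first term approximates `2π` times a Dirac mass as `η → 0`; the second is the cutoff error,
living on `M ≤ ‖z‖ ≤ 2 * M`. -/
theorem divergence_newtonKernel {χ : Plane → ℝ} (hχ : ContDiff ℝ 1 χ) {η : ℝ} (hη : 0 < η)
    (z : Plane) : divergence (newtonKernel χ η) z =
      χ z * (2 * η / (‖z‖ ^ 2 + η) ^ 2) + fderiv ℝ χ z z / (‖z‖ ^ 2 + η) := by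
  have hpos : ‖z‖ ^ 2 + η ≠ 0 := by positivity
  have hχz := (hχ.differentiable one_ne_zero z).hasFDerivAt
  have hN : HasFDerivAt (fun y : Plane => ‖y‖ ^ 2 + η) (2 • innerSL ℝ z) z :=
    (hasStrictFDerivAt_norm_sq z).hasFDerivAt.add_const η
  have hq := hχz.fun_mul ((hasDerivAt_inv hpos).comp_hasFDerivAt z hN)
  have hdiv : divergence (fun y : Plane => y) z = 2 := by
    simp [divergence]
  have h := divergence_smul hq.differentiableAt (differentiableAt_fun_id (𝕜 := ℝ) (x := z))
  simp only [Function.comp_apply, ← div_eq_mul_inv] at h hq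
  unfold newtonKernel
  rw [h, hq.fderiv, hdiv]
  simp
  field_simp
  ring

/-! ### Integrals of a compactly supported kernel over a set -/

/-- The convolution of the characteristic function of `S` with the kernel `k`. -/
noncomputable def smear {E : Type*} [NormedAddCommGroup E] [NormedSpace ℝ E] (S : Set Plane)
    (k : Plane → E) (x : Plane) : E := ∫ y in S, k (x - y)

theorem integrable_kernel_comp_sub {E : Type*} [NormedAddCommGroup E] {k : Plane → E}
    (hk : Continuous k) (hc : HasCompactSupport k) (x : Plane) :
    Integrable fun y => k (x - y) :=
  (hk.integrable_of_hasCompactSupport hc).comp_sub_left x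

section smear

variable {E : Type*} [NormedAddCommGroup E] [NormedSpace ℝ E] {S : Set Plane} {k : Plane → E}

theorem locallyIntegrable_indicator_one (hS : MeasurableSet S) :
    LocallyIntegrable (S.indicator (1 : Plane → ℝ)) :=
  (locallyIntegrable_const (1 : ℝ)).indicator hS

theorem smear_eq_convolution (hS : MeasurableSet S) (k : Plane → E) :
    smear S k = convolution (S.indicator (1 : Plane → ℝ)) k
      (ContinuousLinearMap.lsmul ℝ ℝ) volume := by
  ext x
  rw [smear, convolution, ← integral_indicator hS]
  congr 1
  ext y
  by_cases hy : y ∈ S <;> simp [hy]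

theorem contDiff_smear (hS : MeasurableSet S) (hk : ContDiff ℝ 1 k) (hc : HasCompactSupport k) :
    ContDiff ℝ 1 (smear S k) := by
  rw [smear_eq_convolution hS]
  exact_mod_cast hc.contDiff_convolution_right (n := 1) (ContinuousLinearMap.lsmul ℝ ℝ)
    (locallyIntegrable_indicator_one hS) hk

theorem fderiv_smear (hS : MeasurableSet S) (hk : ContDiff ℝ 1 k) (hc : HasCompactSupport k)
    (x : Plane) : fderiv ℝ (smear S k) x = smear S (fderiv ℝ k) x := by
  rw [smear_eq_convolution hS, (hc.hasFDerivAt_convolution_right _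
    (locallyIntegrable_indicator_one hS) hk x).fderiv, convolution, smear, ← integral_indicator hS]
  congr 1
  ext y v
  by_cases hy : y ∈ S <;> simp [hy, ContinuousLinearMap.precompR_apply]

theorem divergence_smear (hS : MeasurableSet S) {k : Plane → Plane} (hk : ContDiff ℝ 1 k)
    (hc : HasCompactSupport k) (x : Plane) :
    divergence (smear S k) x = smear S (divergence k) x := by
  have hint : Integrable fun y => fderiv ℝ k (x - y) :=
    integrable_kernel_comp_sub (hk.continuous_fderiv one_ne_zero) (hc.fderiv ℝ) x
  have hap : ∀ i : Fin 2, (∫ y in S, fderiv ℝ k (x - y)) (EuclideanSpace.single i 1) i =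
      ∫ y in S, fderiv ℝ k (x - y) (EuclideanSpace.single i 1) i := by
    intro i
    let T : (Plane →L[ℝ] Plane) →L[ℝ] ℝ := (EuclideanSpace.proj i).comp
      (ContinuousLinearMap.apply ℝ Plane (EuclideanSpace.single i 1))
    exact (T.integral_comp_comm hint.integrableOn).symm
  rw [divergence, fderiv_smear hS hk hc]
  simp only [smear, hap, divergence]
  rw [integral_finsetSum]
  intro i _
  let T : (Plane →L[ℝ] Plane) →L[ℝ] ℝ := (EuclideanSpace.proj i).comp
    (ContinuousLinearMap.apply ℝ Plane (EuclideanSpace.single i 1))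
  exact (T.integrable_comp hint).integrableOn

theorem smear_add_single (L : ℝ) (A : Set Plane) (k : Plane → E) (x : Plane) (i : Fin 2) :
    smear (periodize L A) k (x + EuclideanSpace.single i L) = smear (periodize L A) k x := by
  set v : Plane := EuclideanSpace.single i L with hv
  have hmp := measurePreserving_add_right (volume : Measure Plane) v
  have he : MeasurableEmbedding (fun y : Plane => y + v) :=
    (MeasurableEquiv.addRight v).measurableEmbedding
  have hpre : (fun y : Plane => y + v) ⁻¹' periodize L A = periodize L A := by
    ext y
    exact add_single_mem_periodize_iff L A y i
  rw [smear, ← hmp.setIntegral_preimage_emb he, hpre]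
  simp [smear]

theorem smear_indicator_ball (S : Set Plane) (c ρ : ℝ) (x : Plane) :
    smear S ((Metric.ball (0 : Plane) ρ).indicator fun _ => c) x =
      c * volume.real (S ∩ Metric.ball x ρ) := by
  have : ∀ y, (Metric.ball (0 : Plane) ρ).indicator (fun _ => c) (x - y) =
      (Metric.ball x ρ).indicator (fun _ => c) y := by
    intro y
    by_cases hy : y ∈ Metric.ball x ρ
    · rw [indicator_of_mem hy, indicator_of_mem]
      rwa [mem_ball_zero_iff, ← dist_eq_norm, dist_comm]
    · rw [indicator_of_notMem hy, indicator_of_notMem]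
      rwa [mem_ball_zero_iff, ← dist_eq_norm, dist_comm]
  simp only [smear, this]
  rw [setIntegral_indicator measurableSet_ball]
  simp [mul_comm]

theorem integrable_indicator_ball_comp_sub (c ρ : ℝ) (x : Plane) :
    Integrable fun y => (Metric.ball (0 : Plane) ρ).indicator (fun _ => c) (x - y) := by
  have h : Integrable ((Metric.ball (0 : Plane) ρ).indicator fun _ => c) :=
    (integrable_indicator_iff measurableSet_ball).2 (integrableOn_const measure_ball_lt_top.ne)
  exact h.comp_sub_left x

end smear

/-! ### Mass of the regularised Dirac kernel -/

theorem integral_ball_poisson {η r : ℝ} (hη : 0 < η) (hr : 0 < r) (x : Plane) :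
    ∫ y in Metric.ball x r, 2 * η / (‖x - y‖ ^ 2 + η) ^ 2 =
      2 * Real.pi * (r ^ 2 / (r ^ 2 + η)) := by
  let F : ℝ → ℝ := (Iio r).indicator fun s => 2 * η / (s ^ 2 + η) ^ 2
  have h1 : ∫ y in Metric.ball x r, 2 * η / (‖x - y‖ ^ 2 + η) ^ 2 = ∫ y : Plane, F ‖x - y‖ := by
    rw [← integral_indicator measurableSet_ball]
    congr 1
    ext y
    by_cases hy : y ∈ Metric.ball x r
    · have : ‖x - y‖ < r := by rwa [← dist_eq_norm, dist_comm]
      simp [F, hy, this]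
    · have : ¬ ‖x - y‖ < r := by rwa [← dist_eq_norm, dist_comm]
      rw [indicator_of_notMem hy]
      simp only [F]
      rw [indicator_of_notMem (by simpa using this)]
  have h2 : ∫ s in Ioi (0 : ℝ), s ^ (Module.finrank ℝ Plane - 1) • F s =
      r ^ 2 / (r ^ 2 + η) := by
    have : ∀ s, s ^ (Module.finrank ℝ Plane - 1) • F s =
        (Iio r).indicator (fun s => 2 * η * s / (s ^ 2 + η) ^ 2) s := by
      intro s
      by_cases hs : s ∈ Iio r
      · simp only [F, indicator_of_mem hs]
        simp
        ring
      · simp only [F, indicator_of_notMem hs]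
        simp
    simp_rw [this]
    rw [setIntegral_indicator measurableSet_Iio, Ioi_inter_Iio, ← integral_Ioc_eq_integral_Ioo,
      ← intervalIntegral.integral_of_le hr.le]
    have hd : ∀ s ∈ uIcc 0 r, HasDerivAt (fun s : ℝ => s ^ 2 / (s ^ 2 + η))
        (2 * η * s / (s ^ 2 + η) ^ 2) s := by
      intro s _
      have hp : s ^ 2 + η ≠ 0 := by positivity
      have h := (hasDerivAt_pow 2 s).div ((hasDerivAt_pow 2 s).add_const η) hp
      refine h.congr_deriv ?_
      congr 1
      push_cast
      ring
    rw [intervalIntegral.integral_eq_sub_of_hasDerivAt hd]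
    · simp
    · apply Continuous.intervalIntegrable
      apply Continuous.div (by fun_prop) (by fun_prop)
      intro s
      positivity
  rw [h1, integral_sub_left_eq_self (fun z : Plane => F ‖z‖) volume x,
    integral_fun_norm_addHaar, h2]
  simp [Measure.real, EuclideanSpace.volume_ball_fin_two, Real.pi_pos.le]
  ring

/-! ### The calibrating field -/

/-- The denominator of the calibrating field, `π R² + a` with `a` the local area of `S`. -/
noncomputable def areaDenom (S : Set Plane) (χ : Plane → ℝ) (R : ℝ) (x : Plane) : ℝ :=
  Real.pi * R ^ 2 + smear S χ x

/-- The Newtonian field of `S`, normalised by the local area of `S` so as to have length at most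
one. It calibrates the discs of radius `R`. -/
noncomputable def calibration (S : Set Plane) (χ : Plane → ℝ) (R η : ℝ) (x : Plane) : Plane :=
  (2 * R / areaDenom S χ R x) • smear S (newtonKernel χ η) x

section calibration

variable {S : Set Plane} {χ : Plane → ℝ} {C M R η : ℝ}

theorem smear_cutoff_nonneg (h : IsCutoff C M χ) (S : Set Plane) (x : Plane) :
    0 ≤ smear S χ x := integral_nonneg fun _ => h.nonneg _

theorem areaDenom_ge (h : IsCutoff C M χ) (x : Plane) :
    Real.pi * R ^ 2 ≤ areaDenom S χ R x :=
  le_add_of_nonneg_right (smear_cutoff_nonneg h S x)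

theorem areaDenom_pos (h : IsCutoff C M χ) (hR : 0 < R) (x : Plane) : 0 < areaDenom S χ R x :=
  lt_of_lt_of_le (by have := Real.pi_pos; positivity) (areaDenom_ge h x)

theorem contDiff_areaDenom (h : IsCutoff C M χ) (hS : MeasurableSet S) :
    ContDiff ℝ 1 (areaDenom S χ R) :=
  contDiff_const.add (contDiff_smear hS h.contDiff h.hasCompactSupport)

theorem hasCompactSupport_newtonKernel (h : IsCutoff C M χ) (η : ℝ) :
    HasCompactSupport (newtonKernel χ η) := by
  refine h.hasCompactSupport.mono fun z hz hχ => hz ?_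
  simp [newtonKernel, hχ]

theorem contDiff_smear_newtonKernel (h : IsCutoff C M χ) (hS : MeasurableSet S) (hη : 0 < η) :
    ContDiff ℝ 1 (smear S (newtonKernel χ η)) :=
  contDiff_smear hS (contDiff_newtonKernel h.contDiff hη) (hasCompactSupport_newtonKernel h η)

theorem contDiff_calibration (h : IsCutoff C M χ) (hS : MeasurableSet S) (hR : 0 < R)
    (hη : 0 < η) : ContDiff ℝ 1 (calibration S χ R η) :=
  (contDiff_const.div (contDiff_areaDenom h hS) fun x => (areaDenom_pos h hR x).ne').smul
    (contDiff_smear_newtonKernel h hS hη)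

/-- The sharp field bound applied to the density `χ (x - ·)` on `S`. Its mass is `smear S χ x`,
which explains the form of `areaDenom`. -/
theorem norm_smear_newtonKernel_le (h : IsCutoff C M χ) (hS : MeasurableSet S) (hR : 0 < R)
    (hη : 0 < η) (x : Plane) :
    ‖smear S (newtonKernel χ η) x‖ ≤ areaDenom S χ R x / (2 * R) := by
  have hi : Integrable (S.indicator fun y => χ (x - y)) :=
    (integrable_kernel_comp_sub h.contDiff.continuous h.hasCompactSupport x).indicator hS
  have hb := norm_integral_newtonian_le (g := S.indicator fun y => χ (x - y)) hR hη
    (fun y => indicator_nonneg (fun _ _ => h.nonneg _) y)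
    (fun y => indicator_le_self' (fun _ _ => h.nonneg _) y |>.trans (h.le_one _)) hi x
  rw [integral_indicator hS] at hb
  have hV : ∫ y, (S.indicator (fun y => χ (x - y)) y / (‖x - y‖ ^ 2 + η)) • (x - y) =
      smear S (newtonKernel χ η) x := by
    rw [smear, ← integral_indicator hS]
    congr 1
    ext1 y
    by_cases hy : y ∈ S <;> simp [hy, newtonKernel]
  rw [hV] at hb
  refine hb.trans (le_of_eq ?_)
  rw [areaDenom, smear]
  field_simp

theorem norm_calibration_le_one (h : IsCutoff C M χ) (hS : MeasurableSet S) (hR : 0 < R)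
    (hη : 0 < η) (x : Plane) : ‖calibration S χ R η x‖ ≤ 1 := by
  have hD := areaDenom_pos (S := S) h hR x
  rw [calibration, norm_smul, Real.norm_of_nonneg (by positivity)]
  calc 2 * R / areaDenom S χ R x * ‖smear S (newtonKernel χ η) x‖
      ≤ 2 * R / areaDenom S χ R x * (areaDenom S χ R x / (2 * R)) := by
        gcongr
        exact norm_smear_newtonKernel_le h hS hR hη x
    _ = 1 := by field_simp

theorem isTorusTestField_calibration (h : IsCutoff C M χ) (L : ℝ) {A : Set Plane}
    (hA : MeasurableSet A) (hR : 0 < R) (hη : 0 < η) :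
    IsTorusTestField L (calibration (periodize L A) χ R η) where
  contDiff := contDiff_calibration h (measurableSet_periodize hA L) hR hη
  periodic x i := by simp only [calibration, areaDenom, smear_add_single]
  norm_le_one := norm_calibration_le_one h (measurableSet_periodize hA L) hR hη

theorem norm_fderiv_areaDenom_le (h : IsCutoff C M χ) (hM : 0 < M) (hS : MeasurableSet S)
    (x : Plane) : ‖fderiv ℝ (areaDenom S χ R) x‖ ≤
      C / M * volume.real (S ∩ Metric.ball x (3 * M)) := by
  have : fderiv ℝ (areaDenom S χ R) x = smear S (fderiv ℝ χ) x := by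
    unfold areaDenom
    rw [fderiv_const_add, ← fderiv_smear hS h.contDiff h.hasCompactSupport]
  rw [this, ← smear_indicator_ball]
  exact norm_integral_le_of_norm_le (integrable_indicator_ball_comp_sub _ _ x).integrableOn
    (Eventually.of_forall fun y => h.norm_fderiv_le_indicator hM _)

theorem smear_cutoff_le (h : IsCutoff C M χ) (hM : 0 < M) (x : Plane) :
    smear S χ x ≤ volume.real (S ∩ Metric.ball x (3 * M)) := by
  rw [← one_mul (volume.real _), ← smear_indicator_ball]
  exact integral_mono
    (integrable_kernel_comp_sub h.contDiff.continuous h.hasCompactSupport x).integrableOn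
    (integrable_indicator_ball_comp_sub _ _ x).integrableOn fun y => h.le_indicator hM _

/-- The gradient of `χ` vanishes for `‖z‖ < M`; elsewhere `‖z‖ ≥ 1`, so `‖z‖ / (‖z‖ ^ 2 + η) ≤ 1`.
-/
theorem fderiv_cutoff_div_ge (h : IsCutoff C M χ) (hC : 0 ≤ C) (hM : 1 ≤ M) (hη : 0 < η)
    (z : Plane) : -(Metric.ball (0 : Plane) (3 * M)).indicator (fun _ => C / M) z ≤
      fderiv ℝ χ z z / (‖z‖ ^ 2 + η) := by
  have hM0 : 0 < M := by linarith
  rcases lt_or_ge ‖z‖ M with hz | hz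
  · rw [h.fderiv_eq_zero_of_norm_lt hz]
    simp only [zero_apply, zero_div, Left.neg_nonpos_iff]
    exact indicator_nonneg (fun _ _ => by positivity) z
  · have hz1 : 1 ≤ ‖z‖ := hM.trans hz
    have h1 : |fderiv ℝ χ z z| ≤ ‖fderiv ℝ χ z‖ * ‖z‖ := (fderiv ℝ χ z).le_opNorm z
    have h2 : |fderiv ℝ χ z z / (‖z‖ ^ 2 + η)| ≤ ‖fderiv ℝ χ z‖ := by
      rw [abs_div, abs_of_pos (by positivity : 0 < ‖z‖ ^ 2 + η), div_le_iff₀ (by positivity)]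
      refine h1.trans ?_
      gcongr
      nlinarith
    have h3 := h.norm_fderiv_le_indicator hM0 z
    have := neg_abs_le (fderiv ℝ χ z z / (‖z‖ ^ 2 + η))
    linarith

/-- The regularised Dirac kernel. -/
noncomputable def diracKernel (χ : Plane → ℝ) (η : ℝ) (z : Plane) : ℝ :=
  χ z * (2 * η / (‖z‖ ^ 2 + η) ^ 2)

theorem diracKernel_nonneg (h : IsCutoff C M χ) (hη : 0 < η) (z : Plane) :
    0 ≤ diracKernel χ η z := mul_nonneg (h.nonneg z) (by positivity)

theorem integrable_diracKernel (h : IsCutoff C M χ) (hη : 0 < η) (x : Plane) :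
    Integrable fun y => diracKernel χ η (x - y) := by
  apply integrable_kernel_comp_sub
  · apply h.contDiff.continuous.mul
    refine Continuous.div (by fun_prop) (by fun_prop) fun z => ?_
    positivity
  · exact h.hasCompactSupport.mul_right

theorem divergence_smear_newtonKernel_ge (h : IsCutoff C M χ) (hC : 0 ≤ C) (hM : 1 ≤ M)
    (hS : MeasurableSet S) (hη : 0 < η) (x : Plane) :
    smear S (diracKernel χ η) x - C / M * volume.real (S ∩ Metric.ball x (3 * M)) ≤
      divergence (smear S (newtonKernel χ η)) x := by
  have hk := contDiff_newtonKernel h.contDiff hη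
  have hi : Integrable fun y => divergence (newtonKernel χ η) (x - y) := by
    apply integrable_kernel_comp_sub (continuous_divergence hk)
    refine ((hasCompactSupport_newtonKernel h η).fderiv ℝ).mono fun z hz hz0 => hz ?_
    simp [divergence, hz0]
  rw [divergence_smear hS hk (hasCompactSupport_newtonKernel h η), ← smear_indicator_ball, smear,
    smear, ← integral_sub (integrable_diracKernel h hη x).integrableOn
      (integrable_indicator_ball_comp_sub _ _ x).integrableOn]
  refine integral_mono ((integrable_diracKernel h hη x).sub
    (integrable_indicator_ball_comp_sub _ _ x)).integrableOn hi.integrableOn fun y => ?_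
  simp only
  rw [divergence_newtonKernel h.contDiff hη, diracKernel]
  have := fderiv_cutoff_div_ge h hC hM hη (x - y)
  linarith

/-- There are two errors: the cutoff of the kernel, and the gradient of the normalising factor. In
the second, the bound `D / (2 * R)` on the field cancels one power of the denominator `D`. -/
theorem divergence_calibration_ge (h : IsCutoff C M χ) (hC : 0 ≤ C) (hM : 1 ≤ M) (hR : 1 ≤ R)
    (hS : MeasurableSet S) (hη : 0 < η) (x : Plane) :
    2 * R / areaDenom S χ R x * smear S (diracKernel χ η) x -
        C / M * volume.real (S ∩ Metric.ball x (3 * M)) ≤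
      divergence (calibration S χ R η) x := by
  have hR0 : 0 < R := by linarith
  have hM0 : 0 < M := by linarith
  have hpi := Real.pi_gt_three
  set D := areaDenom S χ R x with hDdef
  set V := smear S (newtonKernel χ η) x with hV
  set b := volume.real (S ∩ Metric.ball x (3 * M)) with hb
  have hb0 : 0 ≤ b := measureReal_nonneg
  have hD : 0 < D := areaDenom_pos h hR0 x
  have hDge : Real.pi * R ^ 2 ≤ D := areaDenom_ge h x
  have hdD : HasFDerivAt (areaDenom S χ R) (fderiv ℝ (areaDenom S χ R) x) x :=
    ((contDiff_areaDenom h hS).differentiable one_ne_zero x).hasFDerivAt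
  have hu : HasFDerivAt (fun y => 2 * R / areaDenom S χ R y)
      ((2 * R) • ((-(D ^ 2)⁻¹) • fderiv ℝ (areaDenom S χ R) x)) x := by
    have := ((hasDerivAt_inv hD.ne').comp_hasFDerivAt x hdD).const_mul (2 * R)
    simpa only [div_eq_mul_inv, Function.comp_apply] using this
  have hdiv := divergence_smul hu.differentiableAt
    ((contDiff_smear_newtonKernel h hS hη).differentiable one_ne_zero x)
  have hVle : ‖V‖ ≤ D / (2 * R) := norm_smear_newtonKernel_le h hS hR0 hη x
  have hdle := norm_fderiv_areaDenom_le (R := R) h hM0 hS x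
  have herr : |fderiv ℝ (fun y => 2 * R / areaDenom S χ R y) x V| ≤ C / M * b / D := by
    rw [hu.fderiv]
    simp only [smul_apply, smul_eq_mul]
    rw [abs_mul, abs_of_pos (by positivity : 0 < 2 * R), abs_mul, abs_neg,
      abs_of_pos (by positivity : 0 < (D ^ 2)⁻¹)]
    calc 2 * R * ((D ^ 2)⁻¹ * |fderiv ℝ (areaDenom S χ R) x V|)
        ≤ 2 * R * ((D ^ 2)⁻¹ * ((C / M * b) * (D / (2 * R)))) := by
          gcongr
          exact ((fderiv ℝ (areaDenom S χ R) x).le_opNorm V).trans (by gcongr)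
      _ = C / M * b / D := by field_simp
  have hmain := divergence_smear_newtonKernel_ge h hC hM hS hη x
  have hE : 0 ≤ C / M * b := by positivity
  -- The two errors together carry the factor `(2 * R + 1) / D`, at most one because `D ≥ π R² ≥ 3
  -- R² ≥ 2 R + 1`.
  have hsmall : 2 * R / D * (C / M * b) + C / M * b / D ≤ C / M * b := by
    have : 2 * R / D * (C / M * b) + C / M * b / D = C / M * b * ((2 * R + 1) / D) := by ring
    rw [this]
    apply mul_le_of_le_one_right hE
    rw [div_le_one hD]
    nlinarith
  have hmul : 2 * R / D * (smear S (diracKernel χ η) x - C / M * b) ≤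
      2 * R / D * divergence (smear S (newtonKernel χ η)) x := by gcongr
  have hneg := neg_abs_le (fderiv ℝ (fun y => 2 * R / areaDenom S χ R y) x V)
  calc _ ≤ 2 * R / D * divergence (smear S (newtonKernel χ η)) x +
        fderiv ℝ (fun y => 2 * R / areaDenom S χ R y) x V := by linarith
    _ = _ := hdiv.symm

/-- The mass of the kernel in the disc of radius `r`, minus the part lost outside `S`, where the
kernel is at most its peak value `2 / η`. -/
theorem smear_diracKernel_ge (h : IsCutoff C M χ) (hS : MeasurableSet S) (hη : 0 < η) {r : ℝ}
    (hr : 0 < r) (hrM : r ≤ M) (x : Plane) :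
    2 * Real.pi * (r ^ 2 / (r ^ 2 + η)) - 2 / η * volume.real (Metric.ball x r \ S) ≤
      smear S (diracKernel χ η) x := by
  set p : Plane → ℝ := fun y => 2 * η / (‖x - y‖ ^ 2 + η) ^ 2 with hp
  have hpc : Continuous p :=
    Continuous.div (by fun_prop) (by fun_prop) fun z => by positivity
  have hpi : IntegrableOn p (Metric.ball x r) :=
    (hpc.continuousOn.integrableOn_compact (isCompact_closedBall x r)).mono_set
      Metric.ball_subset_closedBall
  have h1 : ∫ y in Metric.ball x r \ S, p y ≤ 2 / η * volume.real (Metric.ball x r \ S) := by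
    have hfin : volume (Metric.ball x r \ S) < ∞ :=
      (measure_mono sdiff_subset).trans_lt measure_ball_lt_top
    calc ∫ y in Metric.ball x r \ S, p y ≤ ∫ y in Metric.ball x r \ S, 2 / η := by
          apply integral_mono (hpi.mono_set sdiff_subset) (integrableOn_const hfin.ne)
          intro y
          simp only [hp]
          rw [div_le_div_iff₀ (by positivity) hη]
          have : 0 ≤ ‖x - y‖ ^ 2 := by positivity
          nlinarith
      _ = _ := by simp [mul_comm]
  have h2 : ∫ y in Metric.ball x r ∩ S, p y ≤ smear S (diracKernel χ η) x := by
    calc ∫ y in Metric.ball x r ∩ S, p y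
        = ∫ y in Metric.ball x r ∩ S, diracKernel χ η (x - y) := by
          apply setIntegral_congr_fun (measurableSet_ball.inter hS)
          intro y hy
          have hyr : ‖x - y‖ < r := by
            have := hy.1
            rwa [Metric.mem_ball, dist_comm, dist_eq_norm] at this
          simp only [diracKernel, hp]
          rw [h.eq_one _ (by linarith), one_mul]
      _ ≤ _ := by
          apply setIntegral_mono_set (integrable_diracKernel h hη x).integrableOn
          · exact Eventually.of_forall fun y => diracKernel_nonneg h hη _
          · exact inter_subset_right.eventuallyLE
  have h3 := integral_inter_add_sdiff hS hpi
  have h4 := integral_ball_poisson hη hr x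
  change ∫ y in Metric.ball x r, p y = _ at h4
  linarith

end calibration

/-! ### The perimeter bound -/

theorem integrableOn_of_continuous_of_isBounded {f : Plane → ℝ} (hf : Continuous f)
    {A : Set Plane} (hA : Bornology.IsBounded A) : IntegrableOn f A :=
  (hf.continuousOn.integrableOn_compact hA.isCompact_closure).mono_set subset_closure

theorem integral_divergence_le_torusPerimeter {L : ℝ} {A : Set Plane}
    (hP : torusPerimeter L A ≠ ∞) {φ : Plane → Plane} (hφ : IsTorusTestField L φ) :
    ∫ x in A, divergence φ x ≤ (torusPerimeter L A).toReal := by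
  rw [← ENNReal.ofReal_le_iff_le_toReal hP]
  exact le_iSup₂ (f := fun (φ : Plane → Plane) (_ : IsTorusTestField L φ) =>
    ENNReal.ofReal (∫ x in A, divergence φ x)) φ hφ

theorem volume_real_ball_plane (x : Plane) {r : ℝ} (hr : 0 ≤ r) :
    volume.real (Metric.ball x r) = Real.pi * r ^ 2 := by
  simp [Measure.real, EuclideanSpace.volume_ball_fin_two, Real.pi_pos.le, hr, mul_comm]

/-- The density theorem in integrated form: the mean relative area of the complement of `S` in
small discs centred in `S` vanishes. -/
theorem tendsto_integral_compl_inter_ball {A S : Set Plane} (hA : volume A < ∞)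
    (hAm : MeasurableSet A) (hAS : A ⊆ S) (hS : MeasurableSet S) :
    Tendsto (fun r : ℝ => ∫ x in A, volume.real (Sᶜ ∩ Metric.ball x r) / r ^ 2) (𝓝[>] 0)
      (𝓝 0) := by
  have hbound : ∀ (r : ℝ), 0 < r → ∀ x : Plane,
      volume.real (Sᶜ ∩ Metric.ball x r) / r ^ 2 ≤ Real.pi := by
    intro r hr x
    rw [div_le_iff₀ (by positivity), ← volume_real_ball_plane x hr.le]
    exact measureReal_mono inter_subset_right measure_ball_lt_top.ne
  have hlim : Tendsto (fun r : ℝ => ∫ x in A, volume.real (Sᶜ ∩ Metric.ball x r) / r ^ 2)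
      (𝓝[>] 0) (𝓝 (∫ x in A, (0 : ℝ))) := by
    apply tendsto_integral_filter_of_dominated_convergence fun _ => Real.pi
    · exact Eventually.of_forall fun r =>
        ((integrable_measureReal_inter_ball hA hS.compl r).div_const _).aestronglyMeasurable
    · filter_upwards [self_mem_nhdsWithin] with r hr
      refine Eventually.of_forall fun x => ?_
      rw [Real.norm_of_nonneg (by positivity)]
      exact hbound r hr x
    · exact integrableOn_const hA.ne
    · have hd := ae_restrict_of_ae (s := A)
        (Besicovitch.ae_tendsto_measure_inter_div_of_measurableSet (volume : Measure Plane)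
          hS.compl)
      filter_upwards [hd, ae_restrict_mem hAm] with x hx hxA
      have hx0 : Sᶜ.indicator (1 : Plane → ℝ≥0∞) x = 0 := by simp [hAS hxA]
      rw [hx0] at hx
      have hx' := ((ENNReal.tendsto_toReal zero_ne_top).comp hx).const_mul Real.pi
      simp only [toReal_zero, mul_zero, Function.comp_apply] at hx'
      refine squeeze_zero' (Eventually.of_forall fun r => by positivity) ?_ hx'
      filter_upwards [self_mem_nhdsWithin] with r hr
      have hr0 : (0 : ℝ) < r := hr
      have hpi := Real.pi_pos
      rw [ENNReal.toReal_div, ← Measure.real, ← Measure.real,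
        Measure.addHaar_real_closedBall_eq_addHaar_real_ball, volume_real_ball_plane x hr0.le,
        ← mul_div_assoc, mul_div_mul_left _ _ hpi.ne']
      gcongr
      · exact (measure_mono inter_subset_right).trans_lt measure_closedBall_lt_top |>.ne
      · exact Metric.ball_subset_closedBall
  simpa using hlim

section perimeter

variable {L C M R : ℝ} {A : Set Plane} {χ : Plane → ℝ}

theorem perimeter_ge_of_radius (h : IsCutoff C M χ) (hC : 0 ≤ C) (hM : 1 ≤ M) (hR : 1 ≤ R)
    (hA : A ⊆ torusCell L) (hAm : MeasurableSet A) (hP : torusPerimeter L A ≠ ∞) {K r : ℝ}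
    (hK : 0 < K) (hr : 0 < r) (hrM : r ≤ M) :
    2 * Real.pi * (K ^ 2 / (K ^ 2 + 1)) * (∫ x in A, 2 * R / areaDenom (periodize L A) χ R x) -
        2 * K ^ 2 * (∫ x in A, volume.real ((periodize L A)ᶜ ∩ Metric.ball x r) / r ^ 2) -
        C / M * (∫ x in A, volume.real (periodize L A ∩ Metric.ball x (3 * M))) ≤
      (torusPerimeter L A).toReal := by
  have hR0 : 0 < R := by linarith
  have hpi := Real.pi_gt_three
  have hAfin := measure_lt_top_of_subset_torusCell hA
  have hAb := isBounded_of_subset_torusCell hA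
  set S := periodize L A with hSdef
  have hS : MeasurableSet S := measurableSet_periodize hAm L
  -- With `η = r² / K²` the captured mass depends on `K` alone, and the loss is `2 * K ^ 2` times a
  -- relative area at scale `r`.
  have hη : 0 < r ^ 2 / K ^ 2 := by positivity
  have hu : Continuous fun x => 2 * R / areaDenom S χ R x :=
    continuous_const.div (contDiff_areaDenom h hS).continuous fun x => (areaDenom_pos h hR0 x).ne'
  have hui := integrableOn_of_continuous_of_isBounded hu hAb
  have hwi : IntegrableOn (fun x => volume.real (Sᶜ ∩ Metric.ball x r) / r ^ 2) A :=
    (integrable_measureReal_inter_ball hAfin hS.compl r).div_const _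
  have hbi := integrable_measureReal_inter_ball hAfin hS (3 * M)
  have hdi := integrableOn_of_continuous_of_isBounded
    (continuous_divergence (contDiff_calibration h hS hR0 hη)) hAb
  have hsub : IntegrableOn (fun x => 2 * Real.pi * (K ^ 2 / (K ^ 2 + 1)) *
      (2 * R / areaDenom S χ R x) - 2 * K ^ 2 * (volume.real (Sᶜ ∩ Metric.ball x r) / r ^ 2)) A :=
    (hui.const_mul _).sub (hwi.const_mul _)
  refine le_trans ?_ (integral_divergence_le_torusPerimeter hP
    (isTorusTestField_calibration h L hAm hR0 hη))
  rw [← integral_const_mul, ← integral_const_mul, ← integral_const_mul,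
    ← integral_sub (hui.const_mul _) (hwi.const_mul _),
    ← integral_sub hsub (hbi.const_mul _)]
  refine integral_mono (hsub.sub (hbi.const_mul _)) hdi fun x => ?_
  refine le_trans ?_ (divergence_calibration_ge h hC hM hR hS hη x)
  simp only
  gcongr
  have hD : 0 < areaDenom S χ R x := areaDenom_pos h hR0 x
  have hu1 : 2 * R / areaDenom S χ R x ≤ 1 := by
    rw [div_le_one hD]
    have : Real.pi * R ^ 2 ≤ areaDenom S χ R x := areaDenom_ge h x
    nlinarith
  have hq := smear_diracKernel_ge h hS hη hr hrM x
  have e1 : r ^ 2 / (r ^ 2 + r ^ 2 / K ^ 2) = K ^ 2 / (K ^ 2 + 1) := by field_simp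
  have e2 : 2 / (r ^ 2 / K ^ 2) * volume.real (Metric.ball x r \ S) =
      2 * K ^ 2 * (volume.real (Sᶜ ∩ Metric.ball x r) / r ^ 2) := by
    rw [sdiff_eq, inter_comm]
    field_simp
  rw [e1, e2] at hq
  have hw : 0 ≤ 2 * K ^ 2 * (volume.real (Sᶜ ∩ Metric.ball x r) / r ^ 2) := by positivity
  have hmul := mul_le_mul_of_nonneg_left hq
    (by positivity : 0 ≤ 2 * R / areaDenom S χ R x)
  have := mul_le_mul_of_nonneg_right hu1 hw
  linarith

/-- The order of limits matters: `r → 0` at fixed `K` removes the loss by the density theorem, then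
`K → ∞` restores the full mass `2π`. -/
theorem perimeter_ge_integral_div_areaDenom (h : IsCutoff C M χ) (hC : 0 ≤ C) (hM : 1 ≤ M)
    (hR : 1 ≤ R) (hA : A ⊆ torusCell L) (hAm : MeasurableSet A) (hP : torusPerimeter L A ≠ ∞) :
    2 * Real.pi * (∫ x in A, 2 * R / areaDenom (periodize L A) χ R x) -
        C / M * (∫ x in A, volume.real (periodize L A ∩ Metric.ball x (3 * M))) ≤
      (torusPerimeter L A).toReal := by
  have hS : MeasurableSet (periodize L A) := measurableSet_periodize hAm L
  have h1 : ∀ K : ℝ, 0 < K →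
      2 * Real.pi * (K ^ 2 / (K ^ 2 + 1)) * (∫ x in A, 2 * R / areaDenom (periodize L A) χ R x) -
        C / M * (∫ x in A, volume.real (periodize L A ∩ Metric.ball x (3 * M))) ≤
      (torusPerimeter L A).toReal := by
    intro K hK
    have ht := ((tendsto_integral_compl_inter_ball (measure_lt_top_of_subset_torusCell hA) hAm
      (subset_periodize L A) hS).const_mul (2 * K ^ 2)).const_sub
      (2 * Real.pi * (K ^ 2 / (K ^ 2 + 1)) *
        (∫ x in A, 2 * R / areaDenom (periodize L A) χ R x))
    have ht' := ht.sub_const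
      (C / M * (∫ x in A, volume.real (periodize L A ∩ Metric.ball x (3 * M))))
    rw [mul_zero, sub_zero] at ht'
    refine le_of_tendsto ht' ?_
    filter_upwards [self_mem_nhdsWithin,
      nhdsWithin_le_nhds (Iic_mem_nhds (by linarith : (0 : ℝ) < M))] with r hr hrM
    exact perimeter_ge_of_radius h hC hM hR hA hAm hP hK hr hrM
  have hK : Tendsto (fun K : ℝ => K ^ 2 / (K ^ 2 + 1)) atTop (𝓝 1) := by
    have hinv : Tendsto (fun K : ℝ => 1 - (K ^ 2 + 1)⁻¹) atTop (𝓝 (1 - 0)) :=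
      (tendsto_inv_atTop_zero.comp
        (tendsto_atTop_add_const_right _ 1 (tendsto_pow_atTop two_ne_zero))).const_sub 1
    rw [sub_zero] at hinv
    refine hinv.congr fun K => ?_
    have : K ^ 2 + 1 ≠ 0 := by positivity
    field_simp
    ring
  have ht := ((hK.const_mul (2 * Real.pi)).mul_const
    (∫ x in A, 2 * R / areaDenom (periodize L A) χ R x)).sub_const
    (C / M * (∫ x in A, volume.real (periodize L A ∩ Metric.ball x (3 * M))))
  rw [mul_one] at ht
  refine le_of_tendsto ht ?_
  filter_upwards [eventually_gt_atTop 0] with K hK0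
  exact h1 K hK0

/-- A lower bound for the perimeter that is sharp for discs of radius `R`. -/
theorem perimeter_ge (h : IsCutoff C M χ) (hC : 0 ≤ C) (hM : 1 ≤ M)
    (hR : 1 ≤ R) (hA : A ⊆ torusCell L) (hAm : MeasurableSet A) (hP : torusPerimeter L A ≠ ∞) :
    3 / R * volume.real A - (1 / (Real.pi * R ^ 3) + C / M) *
        (∫ x in A, volume.real (periodize L A ∩ Metric.ball x (3 * M))) ≤
      (torusPerimeter L A).toReal := by
  have hR0 : 0 < R := by linarith
  have hM0 : 0 < M := by linarith
  have hpi := Real.pi_pos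
  have hAfin := measure_lt_top_of_subset_torusCell hA
  refine le_trans ?_ (perimeter_ge_integral_div_areaDenom h hC hM hR hA hAm hP)
  set S := periodize L A with hSdef
  have hS : MeasurableSet S := measurableSet_periodize hAm L
  have hu : Continuous fun x => 2 * R / areaDenom S χ R x :=
    continuous_const.div (contDiff_areaDenom h hS).continuous fun x => (areaDenom_pos h hR0 x).ne'
  have hui := integrableOn_of_continuous_of_isBounded hu (isBounded_of_subset_torusCell hA)
  have hbi := integrable_measureReal_inter_ball hAfin hS (3 * M)
  have hci : IntegrableOn (fun _ : Plane => 3 / R) A := integrableOn_const hAfin.ne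
  -- Convexity of `a ↦ 4πR / (πR² + a)`: the left side comes from its tangent line at `a = πR²`, the
  -- area of the optimal disc. The defect after clearing the denominator is a perfect square.
  have hpt : ∀ x, 3 / R - 1 / (Real.pi * R ^ 3) * volume.real (S ∩ Metric.ball x (3 * M)) ≤
      2 * Real.pi * (2 * R / areaDenom S χ R x) := by
    intro x
    have ha0 := smear_cutoff_nonneg h S x
    have hab := smear_cutoff_le (S := S) h hM0 x
    set a := smear S χ x with ha
    have hD : 0 < Real.pi * R ^ 2 + a := by positivity
    calc 3 / R - 1 / (Real.pi * R ^ 3) * volume.real (S ∩ Metric.ball x (3 * M))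
        ≤ 3 / R - 1 / (Real.pi * R ^ 3) * a := by gcongr
      _ ≤ 2 * Real.pi * (2 * R / (Real.pi * R ^ 2 + a)) := by
        rw [← mul_div_assoc, le_div_iff₀ hD]
        have : (3 / R - 1 / (Real.pi * R ^ 3) * a) * (Real.pi * R ^ 2 + a) =
            2 * Real.pi * (2 * R) - (a - Real.pi * R ^ 2) ^ 2 / (Real.pi * R ^ 3) := by
          field_simp
          ring
        rw [this]
        have : 0 ≤ (a - Real.pi * R ^ 2) ^ 2 / (Real.pi * R ^ 3) := by positivity
        linarith
  have hint : ∫ x in A, (3 / R - 1 / (Real.pi * R ^ 3) *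
      volume.real (S ∩ Metric.ball x (3 * M))) ≤
      ∫ x in A, 2 * Real.pi * (2 * R / areaDenom S χ R x) :=
    integral_mono (hci.sub (hbi.const_mul _)) (hui.const_mul _) hpt
  rw [integral_sub hci (hbi.const_mul _), integral_const_mul,
    integral_const_mul, setIntegral_const, smul_eq_mul] at hint
  linarith

end perimeter

/-! ### The rescaled energy -/

/-- The optimal radius is `3^{1/3}`, where `3 / R = 9^{1/3}`. A slightly larger one keeps `m < 3 /
R` by continuity and makes `3 < R ^ 3` strict, which leaves room for the cutoff error. -/
theorem exists_radius {m : ℝ} (hm : m < (9 : ℝ) ^ ((1 : ℝ) / 3)) :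
    ∃ R : ℝ, 1 ≤ R ∧ 3 < R ^ 3 ∧ m < 3 / R := by
  set R₀ : ℝ := (3 : ℝ) ^ ((1 : ℝ) / 3) with hR₀
  have hpos : 0 < R₀ := by positivity
  have hcube : R₀ ^ 3 = 3 := by
    rw [hR₀, ← Real.rpow_natCast, ← Real.rpow_mul (by norm_num)]
    norm_num
  have hsq : (9 : ℝ) ^ ((1 : ℝ) / 3) = 3 / R₀ := by
    rw [show (9 : ℝ) = 3 * 3 by norm_num, Real.mul_rpow (by norm_num) (by norm_num), ← hR₀,
      eq_div_iff hpos.ne', ← hcube]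
    ring
  have h1 : 1 ≤ R₀ := by
    by_contra! h
    have : R₀ ^ 3 < 1 := pow_lt_one₀ hpos.le h (by norm_num)
    linarith
  rw [hsq] at hm
  have hcont : ContinuousAt (fun R : ℝ => 3 / R) R₀ :=
    continuousAt_const.div continuousAt_id hpos.ne'
  have hev : ∀ᶠ R in 𝓝[>] R₀, m < 3 / R :=
    (hcont.eventually_const_lt hm).filter_mono nhdsWithin_le_nhds
  obtain ⟨R, hmR, hR⟩ := (hev.and self_mem_nhdsWithin).exists
  have hR' : R₀ < R := hR
  refine ⟨R, h1.trans hR'.le, ?_, hmR⟩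
  rw [← hcube]
  gcongr

theorem log_lengthScale {ε : ℝ} (hε : 0 < ε) (hlog : 0 < |Real.log ε|) :
    Real.log (lengthScale ε) = Real.log ε / 3 - Real.log |Real.log ε| / 3 := by
  rw [lengthScale, Real.log_mul (by positivity) (by positivity), Real.log_rpow hε,
    Real.log_rpow hlog]
  ring

theorem lengthScale_pos {ε : ℝ} (hε : 0 < ε) (hlog : 0 < |Real.log ε|) : 0 < lengthScale ε := by
  unfold lengthScale
  positivity

/-- On a fixed disc the kernel has at least its leading order `|ln ε| / 3`. -/
theorem exists_besselK0_ge {κ ρ : ℝ} (hκ : 0 < κ) (hρ : 0 < ρ) :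
    ∃ ε₀ : ℝ, 0 < ε₀ ∧ ∀ ε, 0 < ε → ε ≤ ε₀ → 0 < |Real.log ε| ∧
      ∀ s, 0 < s → s < ρ → |Real.log ε| / 3 ≤ besselK0 (κ * lengthScale ε * s) := by
  -- For `|ln ε| ≥ T`, the term `ln |ln ε| / 3` in `-ln (lengthScale ε)` absorbs the constants `ln
  -- (κρ) + 1/2`, so the bound `|ln ε| / 3` holds without loss.
  set T := max 1 (Real.exp (3 * (Real.log (κ * ρ) + 1 / 2))) with hT
  refine ⟨Real.exp (-T), Real.exp_pos _, fun ε hε hle => ?_⟩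
  have hlogle : Real.log ε ≤ -T := by
    rw [← Real.log_exp (-T)]
    exact Real.log_le_log hε hle
  have hT1 : 1 ≤ T := le_max_left _ _
  have habs : |Real.log ε| = -Real.log ε := abs_of_neg (by linarith)
  have hTle : T ≤ |Real.log ε| := by rw [habs]; linarith
  have hpos : 0 < |Real.log ε| := by linarith
  refine ⟨hpos, fun s hs hsρ => ?_⟩
  have hl := lengthScale_pos hε hpos
  have h1 := neg_log_sub_half_le_besselK0 (mul_pos (mul_pos hκ hl) hs)
  have h2 : Real.log (κ * lengthScale ε * s) ≤
      Real.log (κ * ρ) + Real.log (lengthScale ε) := by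
    rw [← Real.log_mul (by positivity) hl.ne']
    apply Real.log_le_log (by positivity)
    calc κ * lengthScale ε * s ≤ κ * lengthScale ε * ρ := by gcongr
      _ = κ * ρ * lengthScale ε := by ring
  rw [log_lengthScale hε hpos] at h2
  have h3 : 3 * (Real.log (κ * ρ) + 1 / 2) ≤ Real.log |Real.log ε| := by
    rw [Real.le_log_iff_exp_le hpos]
    exact (le_max_right _ _).trans hTle
  linarith

theorem rescaledEnergy_ge {κ δbar : ℝ} (hκ : 0 < κ)
    (hδ : δbar < 1 / 2 * (9 : ℝ) ^ ((1 : ℝ) / 3) * κ ^ 2) :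
    ∃ c : ℝ, 0 < c ∧ ∃ ε₀ : ℝ, 0 < ε₀ ∧ ∀ ε : ℝ, 0 < ε → ε ≤ ε₀ → 0 < |Real.log ε| ∧
      ∀ A, IsAdmissible ε A → |Real.log ε|⁻¹ * (c * volume.real A) ≤ rescaledEnergy κ δbar ε A := by
  have hpi := Real.pi_pos
  have hm : 2 * δbar * (κ ^ 2)⁻¹ < (9 : ℝ) ^ ((1 : ℝ) / 3) := by
    rw [← div_eq_mul_inv, div_lt_iff₀ (by positivity)]
    linarith
  obtain ⟨R, hR1, hR3, hmR⟩ := exists_radius hm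
  obtain ⟨C, hC, hcut⟩ := exists_isCutoff
  -- The slack between the interaction coefficient and the one needed by the perimeter bound; `M` is
  -- chosen so that the cutoff error `C / M` fits in it.
  set s := 1 / (3 * Real.pi) - 1 / (Real.pi * R ^ 3) with hs
  have hs0 : 0 < s := by
    rw [hs, sub_pos]
    apply one_div_lt_one_div_of_lt (by positivity)
    rw [mul_comm]
    gcongr
  set M := max 1 (C / s) with hMdef
  have hM1 : 1 ≤ M := le_max_left _ _
  have hM0 : 0 < M := by linarith
  have hCM : C / M ≤ s := by
    rw [div_le_iff₀ hM0, mul_comm, ← div_le_iff₀ hs0]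
    exact le_max_right _ _
  obtain ⟨χ, hχ⟩ := hcut M hM0
  obtain ⟨ε₀, hε₀, hK⟩ := exists_besselK0_ge hκ (by positivity : 0 < 3 * M)
  refine ⟨3 / R - 2 * δbar * (κ ^ 2)⁻¹, sub_pos.2 hmR, ε₀, hε₀, fun ε hε hle => ?_⟩
  obtain ⟨ht, hKε⟩ := hK ε hε hle
  refine ⟨ht, fun A hA => ?_⟩
  have hl := lengthScale_pos hε ht
  have hper := perimeter_ge hχ hC hM1 hR1 hA.subset hA.measurableSet hA.finite_perimeter
  have hint := interaction_ge hκ hl (by positivity) hA.subset hA.measurableSet hKε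
  rw [rescaledEnergy]
  change _ ≤ (torusPerimeter (rescaledPeriod ε) A).toReal at hper
  change _ / _ * (∫ x in A, volume.real (periodize (rescaledPeriod ε) A ∩ _)) ≤ _ at hint
  set B := ∫ x in A, volume.real (periodize (rescaledPeriod ε) A ∩ Metric.ball x (3 * M)) with hB
  have hB0 : 0 ≤ B := integral_nonneg fun x => measureReal_nonneg
  set J := ∫ x in A, ∫ y in A, screenedKernel κ (lengthScale ε • (x - y)) with hJ
  set t := |Real.log ε| with htdef
  set P := (torusPerimeter (rescaledPeriod ε) A).toReal with hPdef
  have hcoef : (1 / (Real.pi * R ^ 3) + C / M) * B ≤ 1 / (3 * Real.pi) * B := by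
    gcongr
    linarith
  -- The kernel bound `t / 3` with the prefactor `1 / (2π)` cancels one of the two powers of `t`, so
  -- the interaction is of the same order as the perimeter term.
  have hJ' : t⁻¹ * (1 / (3 * Real.pi) * B) ≤ 2 * (t ^ 2)⁻¹ * J := by
    calc t⁻¹ * (1 / (3 * Real.pi) * B) = 2 * (t ^ 2)⁻¹ * (t / 3 / (2 * Real.pi) * B) := by
          field_simp
      _ ≤ 2 * (t ^ 2)⁻¹ * J := by gcongr
  have hP' : t⁻¹ * ((3 / R - 2 * δbar * (κ ^ 2)⁻¹) * volume.real A - 1 / (3 * Real.pi) * B) ≤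
      t⁻¹ * (P - 2 * δbar * (κ ^ 2)⁻¹ * volume.real A) :=
    mul_le_mul_of_nonneg_left (by linarith) (by positivity)
  calc t⁻¹ * ((3 / R - 2 * δbar * (κ ^ 2)⁻¹) * volume.real A)
      = t⁻¹ * ((3 / R - 2 * δbar * (κ ^ 2)⁻¹) * volume.real A - 1 / (3 * Real.pi) * B) +
        t⁻¹ * (1 / (3 * Real.pi) * B) := by ring
    _ ≤ _ := add_le_add hP' hJ'

theorem torusPerimeter_empty (L : ℝ) : torusPerimeter L ∅ = 0 := by
  simp [torusPerimeter]

theorem isAdmissible_empty (ε : ℝ) : IsAdmissible ε ∅ where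
  subset := empty_subset _
  measurableSet := MeasurableSet.empty
  finite_perimeter := by simp [torusPerimeter_empty]

theorem rescaledEnergy_empty (κ δbar ε : ℝ) : rescaledEnergy κ δbar ε ∅ = 0 := by
  simp [rescaledEnergy, torusPerimeter_empty]

theorem propositionp (κ δbar : ℝ) (hκ : 0 < κ)
    (hδ : δbar < 1 / 2 * (9 : ℝ) ^ ((1 : ℝ) / 3) * κ ^ 2) :
    ∃ ε₀ : ℝ, 0 < ε₀ ∧ ∀ ε : ℝ, 0 < ε → ε ≤ ε₀ →
      IsEnergyMinimizer κ δbar ε ∅ ∧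
        ∀ A : Set Plane, IsEnergyMinimizer κ δbar ε A → volume A = 0 := by
  obtain ⟨c, hc, ε₀, hε₀, hE⟩ := rescaledEnergy_ge hκ hδ
  refine ⟨ε₀, hε₀, fun ε hε hle => ?_⟩
  obtain ⟨ht, hA⟩ := hE ε hε hle
  refine ⟨⟨isAdmissible_empty ε, fun B hB => ?_⟩, fun A hmin => ?_⟩
  · rw [rescaledEnergy_empty]
    exact le_trans (by positivity) (hA B hB)
  · have h1 := (hA A hmin.admissible).trans (hmin.energy_le ∅ (isAdmissible_empty ε))
    rw [rescaledEnergy_empty] at h1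
    have hfin := measure_lt_top_of_subset_torusCell hmin.admissible.subset
    by_contra hne
    have hpos : 0 < volume.real A := ENNReal.toReal_pos hne hfin.ne
    have : 0 < |Real.log ε|⁻¹ * (c * volume.real A) := by positivity
    linarith
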